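/- Let $(\mathcal C,\otimes,I,s)$ be a strict symmetric monoidal category (composition written $g\circ f$) with a partial trace, i.e. partial functions $\mathrm{Tr}^U_{X,Y}:\mathcal C(X\otimes U,Y\otimes U)\rightharpoonup\mathcal C(X,Y)$ satisfying the axioms below. Here $\simeq$ is Kleene equality (both sides undefined, or both defined and equal) and $a\preceq b$ means: if $a$ is defined, then $b$ is defined and $a=b$. Naturality: $h\circ\mathrm{Tr}^U(f)\circ g\preceq\mathrm{Tr}^U((h\otimes1_U)\circ f\circ(g\otimes1_U))$. Dinaturality: $\mathrm{Tr}^U((1_Y\otimes g)\circ f)\simeq\mathrm{Tr}^{U'}(f\circ(1_X\otimes g))$ for $f:X\otimes U\to Y\otimes U'$, $g:U'\to U$. Vanishing I: $\mathrm{Tr}^I(f)\simeq f$. Vanishing II: if $\mathrm{Tr}^V(g)$ is defined, then $\mathrm{Tr}^{U\otimes V}(g)\simeq\mathrm{Tr}^U(\mathrm{Tr}^V(g))$. Superposing: $g\otimes\mathrm{Tr}^U(f)\preceq\mathrm{Tr}^U(g\otimes f)$. Yanking: $\mathrm{Tr}^U(s_{U,U})\simeq1_U$. **Paracategories.** A paracategory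 is a directed graph with a partial operation $[-]$ from its paths to its arrows (preserving end points) such that the composite $1_A:=[\epsilon_A]$ of each empty path is defined, $[f]=f$ for paths of length one, and if $[\vec f\,]$ is defined then $[\vec r,[\vec f\,],\vec s\,]\simeq[\vec r,\vec f,\vec s\,]$. A category is a paracategory with $[f_1,\dots,f_n]=f_n\circ\cdots\circ f_1$. A functor of paracategories is a graph morphism $F$ with $F[\vec p\,]\preceq[F\vec p\,]$; it is full (faithful) if it is surjective (injective) on each set of arrows. A strict symmetric monoidal paracategory has, in addition, a total tensor $\otimes$ on objects and arrows, strictly associative and with a strict unit object $I$ (so that $f\otimes1_I=1_I\otimes f=f$), such that $1_A\otimes1_B=1_{A\otimes B}$, $[f,f']\otimes[g,g']\preceq[f\otimes g,f'\otimes g']$, $1\otimes[\vec p\,]\preceq[1\otimes\vec p\,]$ and $[\vec p\,]\otimes1\preceq[\vec p\otimes1]$; and arrows $\sigma_{A,B}:A\otimes B\to B\otimes A$ such that $[\sigma,f]$ and $[g,\sigma]$ are always defined, $[f\otimes1,\sigma]=[\sigma,1\otimes f]$, $[1\otimes g,\sigma]=[\sigma,g\otimes1]$, $[\sigma_{A,B},\sigma_{B,A}]=1_{A\otimes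 B}$ and $[\sigma_{A,B}\otimes1_C,\sigma_{B,A\otimes C}]=1_A\otimes\sigma_{B,C}$. It is compact closed, with given objects $A^*$ and arrows $\eta_A:I\to A\otimes A^*$, $\varepsilon_A:A^*\otimes A\to I$, if $[\eta_A\otimes1_A,1_A\otimes\varepsilon_A]$ and $[1_{A^*}\otimes\eta_A,\varepsilon_A\otimes1_{A^*}]$ are defined and equal to $1_A$ and $1_{A^*}$. **The partial Int construction.** Let $\mathrm{Int}^p(\mathcal C)$ be the following graph with operations. Objects are pairs $(A^+,A^-)$ of objects of $\mathcal C$; arrows $(A^+,A^-)\to(B^+,B^-)$ are arrows $A^+\otimes B^-\to B^+\otimes A^-$ of $\mathcal C$. The composite of the empty path at $(A^+,A^-)$ is $1_{A^+\otimes A^-}$, and $[f]=f$ for paths of length one. For $f_i:(X_i^+,X_i^-)\to(X_{i+1}^+,X_{i+1}^-)$, $1\le i\le n$, $n\ge2$, put $U=X_n^-\otimes\cdots\otimes X_2^-$ and $$[f_1,\dots,f_n]\simeq\mathrm{Tr}^U\big(\epsilon(f_1,\dots,f_n)\circ(1_{X_1^+}\otimes1_{X_{n+1}^-}\otimes\gamma)\big),$$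 where $\gamma:X_n^-\otimes\cdots\otimes X_2^-\to X_2^-\otimes\cdots\otimes X_n^-$ is the order-reversing symmetry and $$\epsilon(f_1,\dots,f_n):X_1^+\otimes X_{n+1}^-\otimes X_2^-\otimes\cdots\otimes X_n^-\to X_{n+1}^+\otimes X_1^-\otimes X_n^-\otimes\cdots\otimes X_2^-$$ is the "pyramid": the strand $X_{n+1}^-$ crosses $X_2^-,\dots,X_n^-$; then $f_1,\dots,f_n$ are applied in turn to the two leftmost strands, where before $f_i$ the strand $X_{i+1}^-$ crosses the strands $X_{1}^-,\dots,X_{i-1}^-$ released by $f_1,\dots,f_{i-1}$ to become adjacent to $X_i^+$; finally the strand $X_1^-$ crosses $X_n^-,\dots,X_2^-$. (The same formula defines $\epsilon(f_1,\dots,f_n)$, with $U=I$, for $n=1$.) The tensor is $(A^+,A^-)\otimes(B^+,B^-)=(A^+\otimes B^+,B^-\otimes A^-)$ with unit $(I,I)$; for $f:(A^+,A^-)\to(C^+,C^-)$ and $g:(B^+,B^-)\to(D^+,D^-)$, $f\otimes g$ is $$A^+B^+D^-C^-\xrightarrow{s\otimes s}B^+A^+C^-D^-\xrightarrow{1\otimes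 f\otimes1}B^+C^+A^-D^-\xrightarrow{s\otimes s}C^+B^+D^-A^-\xrightarrow{1\otimes g\otimes1}C^+D^+B^-A^-;$$ the symmetry is $\sigma=s_{A^+,B^+}\otimes s_{A^-,B^-}$; $(A,B)^*=(B,A)$; and $\eta_{(A,B)}$, $\varepsilon_{(A,B)}$ are given by the identities of $A\otimes B$ and $B\otimes A$ in $\mathcal C$. Let $N:\mathcal C\to\mathrm{Int}^p(\mathcal C)$ be $N(A)=(A,I)$, $N(f)=f$. **Theorem.** 1. $\mathrm{Int}^p(\mathcal C)$, with $[-]$, $\otimes$, $(I,I)$ and $\sigma$, is a strict symmetric monoidal paracategory. 2. For every path of length $n\ge1$, $[f_1,\dots,f_n]\simeq\mathrm{Tr}^U(\epsilon(f_1,\dots,f_n)\circ(1\otimes1\otimes\gamma))$; in particular the left side is defined exactly when the trace is. For a single arrow $f:(X_1^+,X_1^-)\to(X_2^+,X_2^-)$, also $[f]=f=\mathrm{Tr}^{X_1^-}(\epsilon'(f)\circ(1_{X_1^+}\otimes s_{X_2^-,X_1^-}))$, where $\epsilon'(f)=(1\otimes s_{X_1^-,X_1^-})\circ(f\otimes1)\circ(1\otimes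 s_{X_1^-,X_2^-})$. 3. $\mathrm{Int}^p(\mathcal C)$ is a compact closed paracategory with the above $(-)^*$, $\eta$, $\varepsilon$. 4. $N$ is a full and faithful functor of paracategories, and it preserves the trace: if $f:A\otimes U\to B\otimes U$ and $\mathrm{Tr}^U_{A,B}(f)$ is defined, then $[1_{NA}\otimes\eta_{NU},\,Nf\otimes1_{(NU)^*},\,1_{NB}\otimes\sigma_{NU,(NU)^*},\,1_{NB}\otimes\varepsilon_{NU}]$ is defined and equals $N(\mathrm{Tr}^U_{A,B}(f))$. -/

import Mathlib

open CategoryTheory MonoidalCategory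

universe v u

namespace IntPara

/-! ### Paracategories -/

section Paracategories

variable {V : Type u} [Quiver.{v} V]

/-- A partial operation `[-]` taking a path `A ⟶ ⋯ ⟶ B` of a directed graph to an arrow `A ⟶ B`.
Equality of elements of `Part` is Kleene equality. -/
abbrev PathOp (V : Type u) [Quiver.{v} V] :=
  ∀ ⦃A B : V⦄, Quiver.Path A B → Part (A ⟶ B)

/-- The path of length two `f, g`. -/
def path₂ {A B C : V} (f : A ⟶ B) (g : B ⟶ C) : Quiver.Path A C :=
  (Quiver.Path.nil.cons f).cons g

/-- A graph with a partial composition of paths is a paracategory. -/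
structure IsParacategory (c : PathOp V) : Prop where
  /-- `[ε_A]` is defined. -/
  nil_dom : ∀ A : V, (c (Quiver.Path.nil : Quiver.Path A A)).Dom
  /-- `[f]` is defined and equals `f` for paths of length one. -/
  single : ∀ {A B : V} (f : A ⟶ B), c f.toPath = Part.some f
  /-- If `[f⃗]` is defined, then `[r⃗, [f⃗], s⃗]` and `[r⃗, f⃗, s⃗]` are Kleene equal. -/
  assoc : ∀ {A B C D : V} (r : Quiver.Path A B) (f : Quiver.Path B C) (s : Quiver.Path C D),
    ∀ g ∈ c f, c (r.comp (g.toPath.comp s)) = c (r.comp (f.comp s))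

/-- The identity `1_A = [ε_A]` of a paracategory. -/
def IsParacategory.one {c : PathOp V} (h : IsParacategory c) (A : V) : A ⟶ A :=
  (c (Quiver.Path.nil : Quiver.Path A A)).get (h.nil_dom A)

/-- A functor of paracategories: a graph morphism `F` such that whenever `[p⃗]` is defined,
`[F p⃗]` is defined and equals `F [p⃗]`. -/
def IsParaFunctor {W : Type*} [Quiver W] (c : PathOp V) (d : PathOp W) (F : V ⥤q W) : Prop :=
  ∀ {A B : V} (p : Quiver.Path A B), ∀ g ∈ c p, F.map g ∈ d (F.mapPath p)

/-- A graph morphism is full when it is surjective on each set of arrows. -/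
def GraphFull {W : Type*} [Quiver W] (F : V ⥤q W) : Prop :=
  ∀ A B : V, Function.Surjective (fun f : A ⟶ B => F.map f)

/-- A graph morphism is faithful when it is injective on each set of arrows. -/
def GraphFaithful {W : Type*} [Quiver W] (F : V ⥤q W) : Prop :=
  ∀ A B : V, Function.Injective (fun f : A ⟶ B => F.map f)

/-- Every category is a paracategory, with the total composition
`[f₁, …, fₙ] = fₙ ∘ ⋯ ∘ f₁`. -/
def categoryPathOp (C : Type u) [Category.{v} C] : PathOp C :=
  fun _ _ p => Part.some (composePath p)

/-- The operations of a strict symmetric monoidal paracategory (besides composition): a total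
tensor on objects and arrows, a unit object and the symmetries. -/
structure TensorData (V : Type u) [Quiver.{v} V] where
  obj : V → V → V
  hom : ∀ {A A' B B' : V}, (A ⟶ A') → (B ⟶ B') → (obj A B ⟶ obj A' B')
  unit : V
  symm : ∀ A B : V, obj A B ⟶ obj B A

/-- `1_A ⊗ -` as a graph morphism, where `e` is the arrow `1_A`. -/
def TensorData.left (T : TensorData V) {A : V} (e : A ⟶ A) : V ⥤q V where
  obj X := T.obj A X
  map f := T.hom e f

/-- `- ⊗ 1_A` as a graph morphism, where `e` is the arrow `1_A`. -/
def TensorData.right (T : TensorData V) {A : V} (e : A ⟶ A) : V ⥤q V where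
  obj X := T.obj X A
  map f := T.hom f e

/-- Strict symmetric monoidal paracategories. Equations between arrows whose end points are only
propositionally equal are stated with `Quiver.Hom.cast`. -/
structure IsSSMPC (c : PathOp V) (T : TensorData V) : Prop extends IsParacategory c where
  assoc_obj : ∀ A B C : V, T.obj (T.obj A B) C = T.obj A (T.obj B C)
  unit_obj : ∀ A : V, T.obj T.unit A = A
  obj_unit : ∀ A : V, T.obj A T.unit = A
  assoc_hom : ∀ {A A' B B' C C' : V} (f : A ⟶ A') (g : B ⟶ B') (h : C ⟶ C'),
    (T.hom (T.hom f g) h).cast (assoc_obj A B C) (assoc_obj A' B' C') = T.hom f (T.hom g h)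
  unit_hom : ∀ {A B : V} (f : A ⟶ B),
    (T.hom (toIsParacategory.one T.unit) f).cast (unit_obj A) (unit_obj B) = f
  hom_unit : ∀ {A B : V} (f : A ⟶ B),
    (T.hom f (toIsParacategory.one T.unit)).cast (obj_unit A) (obj_unit B) = f
  /-- (a) `1_A ⊗ 1_B = 1_{A ⊗ B}` -/
  one_tensor_one : ∀ A B : V,
    T.hom (toIsParacategory.one A) (toIsParacategory.one B) = toIsParacategory.one (T.obj A B)
  /-- (b) if `[f, f']` and `[g, g']` are defined, then `[f ⊗ g, f' ⊗ g']` is defined and equals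
  `[f, f'] ⊗ [g, g']` -/
  interchange : ∀ {A A' A'' B B' B'' : V} (f : A ⟶ A') (f' : A' ⟶ A'') (g : B ⟶ B')
    (g' : B' ⟶ B''), ∀ k ∈ c (path₂ f f'), ∀ l ∈ c (path₂ g g'),
      T.hom k l ∈ c (path₂ (T.hom f g) (T.hom f' g'))
  /-- (c) if `[p⃗]` is defined, then `[1 ⊗ p⃗]` is defined and equals `1 ⊗ [p⃗]` -/
  one_tensor_path : ∀ (X : V) {A B : V} (p : Quiver.Path A B), ∀ k ∈ c p,
    T.hom (toIsParacategory.one X) k ∈ c ((T.left (toIsParacategory.one X)).mapPath p)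
  /-- (c) if `[p⃗]` is defined, then `[p⃗ ⊗ 1]` is defined and equals `[p⃗] ⊗ 1` -/
  path_tensor_one : ∀ (X : V) {A B : V} (p : Quiver.Path A B), ∀ k ∈ c p,
    T.hom k (toIsParacategory.one X) ∈ c ((T.right (toIsParacategory.one X)).mapPath p)
  symm_comp_dom : ∀ {A B X : V} (f : T.obj B A ⟶ X), (c (path₂ (T.symm A B) f)).Dom
  comp_symm_dom : ∀ {A B Y : V} (g : Y ⟶ T.obj A B), (c (path₂ g (T.symm A B))).Dom
  symm_natural_left : ∀ {A A' : V} (B : V) (f : A ⟶ A'),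
    c (path₂ (T.hom f (toIsParacategory.one B)) (T.symm A' B)) =
      c (path₂ (T.symm A B) (T.hom (toIsParacategory.one B) f))
  symm_natural_right : ∀ (A : V) {B B' : V} (g : B ⟶ B'),
    c (path₂ (T.hom (toIsParacategory.one A) g) (T.symm A B')) =
      c (path₂ (T.symm A B) (T.hom g (toIsParacategory.one A)))
  symm_symm : ∀ A B : V,
    c (path₂ (T.symm A B) (T.symm B A)) = Part.some (toIsParacategory.one (T.obj A B))
  /-- `[σ_{A,B} ⊗ 1_C, σ_{B,A ⊗ C}] = 1_A ⊗ σ_{B,C}` -/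
  symm_hexagon : ∀ A B C : V,
    c (path₂
        ((T.hom (T.symm A B) (toIsParacategory.one C)).cast (assoc_obj A B C) (assoc_obj B A C))
        (T.symm B (T.obj A C))) =
      Part.some
        ((T.hom (toIsParacategory.one A) (T.symm B C)).cast rfl (assoc_obj A C B).symm)

/-- Duals, units `η_A : I ⟶ A ⊗ A*` and counits `ε_A : A* ⊗ A ⟶ I`. -/
structure DualData (T : TensorData V) where
  dual : V → V
  η : ∀ A : V, T.unit ⟶ T.obj A (dual A)
  ε : ∀ A : V, T.obj (dual A) A ⟶ T.unit

/-- (Strict symmetric) compact closed paracategories. -/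
structure IsCompactClosedPara (c : PathOp V) (T : TensorData V) (D : DualData T) : Prop
    extends IsSSMPC c T where
  /-- `[η_A ⊗ 1_A, 1_A ⊗ ε_A]` is defined and equals `1_A` -/
  snake : ∀ A : V,
    c (path₂
        ((T.hom (D.η A) (toIsParacategory.one A)).cast (unit_obj A) (assoc_obj A (D.dual A) A))
        ((T.hom (toIsParacategory.one A) (D.ε A)).cast rfl (obj_unit A))) =
      Part.some (toIsParacategory.one A)
  /-- `[1_{A*} ⊗ η_A, ε_A ⊗ 1_{A*}]` is defined and equals `1_{A*}` -/
  snake_dual : ∀ A : V,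
    c (path₂
        ((T.hom (toIsParacategory.one (D.dual A)) (D.η A)).cast (obj_unit (D.dual A))
          (assoc_obj (D.dual A) A (D.dual A)).symm)
        ((T.hom (D.ε A) (toIsParacategory.one (D.dual A))).cast rfl (unit_obj (D.dual A)))) =
      Part.some (toIsParacategory.one (D.dual A))

/-- The canonical trace `[1_A ⊗ η_U, f ⊗ 1_{U*}, 1_B ⊗ σ_{U,U*}, 1_B ⊗ ε_U]` of an arrow
`f : A ⊗ U ⟶ B ⊗ U` of a compact closed paracategory. -/
def IsCompactClosedPara.trace {c : PathOp V} {T : TensorData V} {D : DualData T}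
    (h : IsCompactClosedPara c T D) {A B U : V} (f : T.obj A U ⟶ T.obj B U) : Part (A ⟶ B) :=
  c ((path₂
      ((T.hom (h.one A) (D.η U)).cast (h.obj_unit A) (h.assoc_obj A U (D.dual U)).symm)
      (T.hom f (h.one (D.dual U)))).comp
    (path₂
      ((T.hom (h.one B) (T.symm U (D.dual U))).cast (h.assoc_obj B U (D.dual U)).symm rfl)
      ((T.hom (h.one B) (D.ε U)).cast rfl (h.obj_unit B))))

end Paracategories

/-! ### Strict symmetric monoidal partially traced categories -/

/-- A monoidal category is strict when its tensor product is strictly associative and unital on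
objects and the associators and unitors are identities. -/
class StrictMonoidal (C : Type u) [Category.{v} C] [MonoidalCategory C] : Prop where
  assoc_obj : ∀ X Y Z : C, (X ⊗ Y) ⊗ Z = X ⊗ (Y ⊗ Z)
  unit_obj : ∀ X : C, 𝟙_ C ⊗ X = X
  obj_unit : ∀ X : C, X ⊗ 𝟙_ C = X
  associator_hom : ∀ X Y Z : C, (α_ X Y Z).hom = eqToHom (assoc_obj X Y Z)
  leftUnitor_hom : ∀ X : C, (λ_ X).hom = eqToHom (unit_obj X)
  rightUnitor_hom : ∀ X : C, (ρ_ X).hom = eqToHom (obj_unit X)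

/-- A partial trace on a symmetric monoidal category. -/
structure PartialTrace (C : Type u) [Category.{v} C] [MonoidalCategory C]
    [SymmetricCategory C] where
  /-- `Tr^U_{X,Y}`; its domain of definition is the trace class. -/
  tr : ∀ {X Y : C} (U : C), (X ⊗ U ⟶ Y ⊗ U) → Part (X ⟶ Y)
  naturality : ∀ {X Y X' Y' U : C} (f : X ⊗ U ⟶ Y ⊗ U) (g : X' ⟶ X) (h : Y ⟶ Y'),
    ∀ t ∈ tr U f, g ≫ t ≫ h ∈ tr U ((g ▷ U) ≫ f ≫ (h ▷ U))
  dinaturality : ∀ {X Y U U' : C} (f : X ⊗ U ⟶ Y ⊗ U') (g : U' ⟶ U),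
    tr U (f ≫ (Y ◁ g)) = tr U' ((X ◁ g) ≫ f)
  vanishing_one : ∀ {X Y : C} (f : X ⊗ 𝟙_ C ⟶ Y ⊗ 𝟙_ C),
    tr (𝟙_ C) f = Part.some ((ρ_ X).inv ≫ f ≫ (ρ_ Y).hom)
  vanishing_two : ∀ {X Y U V : C} (g : (X ⊗ U) ⊗ V ⟶ (Y ⊗ U) ⊗ V), ∀ t ∈ tr V g,
    tr (U ⊗ V) ((α_ X U V).inv ≫ g ≫ (α_ Y U V).hom) = tr U t
  superposing : ∀ {X Y U W Z : C} (f : X ⊗ U ⟶ Y ⊗ U) (g : W ⟶ Z), ∀ t ∈ tr U f,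
    (g ⊗ₘ t) ∈ tr U ((α_ W X U).hom ≫ (g ⊗ₘ f) ≫ (α_ Z Y U).inv)
  yanking : ∀ U : C, tr U (β_ U U).hom = Part.some (𝟙 U)

/-! ### The partial Int construction

All definitions below make sense for a symmetric monoidal category. The associators and unitors
occurring in them are identities when the category is strict. -/

/-- Objects of `Int^p(C)`: pairs `(A⁺, A⁻)` of objects of `C`. -/
@[ext]
structure IntP (C : Type u) where
  pos : C
  neg : C

section Int

variable {C : Type u} [Category.{v} C] [MonoidalCategory C]

/-- Arrows `(A⁺, A⁻) ⟶ (B⁺, B⁻)` of `Int^p(C)`: arrows `A⁺ ⊗ B⁻ ⟶ B⁺ ⊗ A⁻` of `C`. -/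
@[ext]
structure IntP.Hom (A B : IntP C) where
  mor : A.pos ⊗ B.neg ⟶ B.pos ⊗ A.neg

instance : Quiver.{v} (IntP C) where
  Hom := IntP.Hom

/-- For a path `X₁ ⟶ X₂ ⟶ ⋯ ⟶ Xₖ`, the object `X₂⁻ ⊗ X₃⁻ ⊗ ⋯ ⊗ Xₖ⁻`. -/
def fwd {A : IntP C} : ∀ {B : IntP C}, Quiver.Path A B → C
  | _, .nil => 𝟙_ C
  | B, .cons p _ => fwd p ⊗ B.neg

/-- For a path `X₁ ⟶ X₂ ⟶ ⋯ ⟶ Xₖ`, the object `Xₖ⁻ ⊗ ⋯ ⊗ X₃⁻ ⊗ X₂⁻`. -/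
def rev {A : IntP C} : ∀ {B : IntP C}, Quiver.Path A B → C
  | _, .nil => 𝟙_ C
  | B, .cons p _ => B.neg ⊗ rev p

/-- For a path `X₁ ⟶ X₂ ⟶ ⋯ ⟶ Xₖ`, the object `Xₖ₋₁⁻ ⊗ ⋯ ⊗ X₂⁻ ⊗ X₁⁻`. -/
def src {A : IntP C} : ∀ {B : IntP C}, Quiver.Path A B → C
  | _, .nil => 𝟙_ C
  | _, .cons (b := B') p _ => B'.neg ⊗ src p

/-- For a path `X₁ ⟶ ⋯ ⟶ Xₖ`, the structural map
`Xₖ⁻ ⊗ (Xₖ₋₁⁻ ⊗ ⋯ ⊗ X₁⁻) ⟶ (Xₖ⁻ ⊗ ⋯ ⊗ X₂⁻) ⊗ X₁⁻` (an identity in the strict case). -/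
def regroup {A : IntP C} : ∀ {B : IntP C} (p : Quiver.Path A B), B.neg ⊗ src p ⟶ rev p ⊗ A.neg
  | _, .nil => (ρ_ A.neg).hom ≫ (λ_ A.neg).inv
  | B, .cons p _ => (B.neg ◁ regroup p) ≫ (α_ B.neg (rev p) A.neg).inv

/-- The structural isomorphism `(X ⊗ Y) ⊗ (Z ⊗ W) ≅ X ⊗ ((Y ⊗ Z) ⊗ W)`. -/
def midAssoc (X Y Z W : C) : (X ⊗ Y) ⊗ (Z ⊗ W) ≅ X ⊗ ((Y ⊗ Z) ⊗ W) :=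
  α_ X Y (Z ⊗ W) ≪≫ whiskerLeftIso X (α_ Y Z W).symm

/-- The identity of `(A⁺, A⁻)` is the identity of `A⁺ ⊗ A⁻`. -/
def IntP.id (A : IntP C) : A ⟶ A := ⟨𝟙 (A.pos ⊗ A.neg)⟩

variable [SymmetricCategory C]

/-- The order reversing symmetry `γ : Xₖ⁻ ⊗ ⋯ ⊗ X₂⁻ ⟶ X₂⁻ ⊗ ⋯ ⊗ Xₖ⁻`. -/
def γ {A : IntP C} : ∀ {B : IntP C} (p : Quiver.Path A B), rev p ⟶ fwd p
  | _, .nil => 𝟙 _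
  | B, .cons p _ => (β_ B.neg (rev p)).hom ≫ (γ p ▷ B.neg)

/-- The triangular part of the pyramid of a path `f₁, …, fₖ`, `fᵢ : Xᵢ ⟶ Xᵢ₊₁`, lying between
its two outer edges, as a map
`X₁⁺ ⊗ (X₂⁻ ⊗ ⋯ ⊗ Xₖ₊₁⁻) ⟶ Xₖ₊₁⁺ ⊗ (Xₖ⁻ ⊗ ⋯ ⊗ X₁⁻)`:
before `fₖ` is applied, the strand `Xₖ₊₁⁻` descends along the adjacent crossings with the strands
`X₁⁻, …, Xₖ₋₁⁻` released by `f₁, …, fₖ₋₁`. -/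
def core {A : IntP C} : ∀ {B : IntP C} (p : Quiver.Path A B),
    A.pos ⊗ fwd p ⟶ B.pos ⊗ src p
  | _, .nil => 𝟙 _
  | B, .cons (b := B') p f =>
      (α_ A.pos (fwd p) B.neg).inv ≫ (core p ▷ B.neg) ≫ (α_ B'.pos (src p) B.neg).hom ≫
        (B'.pos ◁ (β_ (src p) B.neg).hom) ≫ (α_ B'.pos B.neg (src p)).inv ≫
        (f.mor ▷ src p) ≫ (α_ B.pos B'.neg (src p)).hom

/-- The pyramid `ε(f₁, …, fₙ)` of a path `f₁, …, fₙ`, `fᵢ : Xᵢ ⟶ Xᵢ₊₁`, `n ≥ 1` (where `p` is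
`f₁, …, fₙ₋₁` and `f` is `fₙ`), as a map
`(X₁⁺ ⊗ Xₙ₊₁⁻) ⊗ (X₂⁻ ⊗ ⋯ ⊗ Xₙ⁻) ⟶ (Xₙ₊₁⁺ ⊗ X₁⁻) ⊗ (Xₙ⁻ ⊗ ⋯ ⊗ X₂⁻)`.
Its left edge is the strand `Xₙ₊₁⁻` rising across `X₂⁻, …, Xₙ⁻`, its right edge is the strand
`X₁⁻` descending across `Xₙ⁻, …, X₂⁻`. -/
def pyramid {A B D : IntP C} (p : Quiver.Path A B) (f : B ⟶ D) :
    (A.pos ⊗ D.neg) ⊗ fwd p ⟶ (D.pos ⊗ A.neg) ⊗ rev p :=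
  (α_ A.pos D.neg (fwd p)).hom ≫ (A.pos ◁ (β_ D.neg (fwd p)).hom) ≫
    core (p.cons f) ≫ (D.pos ◁ regroup p) ≫
    (D.pos ◁ (β_ (rev p) A.neg).hom) ≫ (α_ D.pos A.neg (rev p)).inv

/-- The arrow `ε(f₁, …, fₙ) ∘ (1 ⊗ 1 ⊗ γ)` whose trace over `U = Xₙ⁻ ⊗ ⋯ ⊗ X₂⁻` is the
composite `[f₁, …, fₙ]`. -/
def pyramidTwisted {A B D : IntP C} (p : Quiver.Path A B) (f : B ⟶ D) :
    (A.pos ⊗ D.neg) ⊗ rev p ⟶ (D.pos ⊗ A.neg) ⊗ rev p :=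
  ((A.pos ⊗ D.neg) ◁ γ p) ≫ pyramid p f

/-- The pyramid `ε(f)` of a single arrow `f : (X₁⁺, X₁⁻) ⟶ (X₂⁺, X₂⁻)`, a map
`(X₁⁺ ⊗ X₁⁻) ⊗ X₂⁻ ⟶ (X₂⁺ ⊗ X₁⁻) ⊗ X₁⁻` in which a crossing precedes and a crossing follows
`f`. -/
def pyramidOne {A B : IntP C} (f : A ⟶ B) :
    (A.pos ⊗ A.neg) ⊗ B.neg ⟶ (B.pos ⊗ A.neg) ⊗ A.neg :=
  (α_ A.pos A.neg B.neg).hom ≫ (A.pos ◁ (β_ A.neg B.neg).hom) ≫ (α_ A.pos B.neg A.neg).inv ≫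
    (f.mor ▷ A.neg) ≫
    (α_ B.pos A.neg A.neg).hom ≫ (B.pos ◁ (β_ A.neg A.neg).hom) ≫ (α_ B.pos A.neg A.neg).inv

/-- `ε(f) ∘ (1_{X₁⁺} ⊗ σ_{X₂⁻,X₁⁻})`. -/
def pyramidOneTwisted {A B : IntP C} (f : A ⟶ B) :
    (A.pos ⊗ B.neg) ⊗ A.neg ⟶ (B.pos ⊗ A.neg) ⊗ A.neg :=
  (α_ A.pos B.neg A.neg).hom ≫ (A.pos ◁ (β_ B.neg A.neg).hom) ≫ (α_ A.pos A.neg B.neg).inv ≫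
    pyramidOne f

/-- The partial composition of `Int^p(C)`: identities on empty paths, `[f] = f` on paths of
length one, and the trace of the pyramid on longer paths. -/
def intComp (T : PartialTrace C) : PathOp (IntP C)
  | A, _, .nil => Part.some (IntP.id A)
  | _, _, .cons .nil f => Part.some f
  | _, _, .cons (.cons p g) f =>
      (T.tr (rev (p.cons g)) (pyramidTwisted (p.cons g) f)).map IntP.Hom.mk

/-- `(A⁺, A⁻) ⊗ (B⁺, B⁻) = (A⁺ ⊗ B⁺, B⁻ ⊗ A⁻)`. -/
def IntP.tensor (A B : IntP C) : IntP C := ⟨A.pos ⊗ B.pos, B.neg ⊗ A.neg⟩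

/-- The tensor of arrows of `Int^p(C)`:
`A⁺ B⁺ D⁻ C⁻ ⟶ B⁺ A⁺ C⁻ D⁻ ⟶ B⁺ C⁺ A⁻ D⁻ ⟶ C⁺ B⁺ D⁻ A⁻ ⟶ C⁺ D⁺ B⁻ A⁻`,
the four maps being `s ⊗ s`, `1 ⊗ f ⊗ 1`, `s ⊗ s`, `1 ⊗ g ⊗ 1`. -/
def IntP.tensorHom {A A' B B' : IntP C} (f : A ⟶ A') (g : B ⟶ B') :
    IntP.tensor A B ⟶ IntP.tensor A' B' :=
  ⟨((β_ A.pos B.pos).hom ⊗ₘ (β_ B'.neg A'.neg).hom) ≫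
    (midAssoc B.pos A.pos A'.neg B'.neg).hom ≫ (B.pos ◁ (f.mor ▷ B'.neg)) ≫
    (midAssoc B.pos A'.pos A.neg B'.neg).inv ≫
    ((β_ B.pos A'.pos).hom ⊗ₘ (β_ A.neg B'.neg).hom) ≫
    (midAssoc A'.pos B.pos B'.neg A.neg).hom ≫ (A'.pos ◁ (g.mor ▷ A.neg)) ≫
    (midAssoc A'.pos B'.pos B.neg A.neg).inv⟩

/-- The tensor, the unit `(I, I)` and the symmetries `σ = s_{A⁺,B⁺} ⊗ s_{A⁻,B⁻}` of
`Int^p(C)`. -/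
def intTensor (C : Type u) [Category.{v} C] [MonoidalCategory C] [SymmetricCategory C] :
    TensorData (IntP C) where
  obj := IntP.tensor
  hom f g := IntP.tensorHom f g
  unit := ⟨𝟙_ C, 𝟙_ C⟩
  symm A B := ⟨(β_ A.pos B.pos).hom ⊗ₘ (β_ A.neg B.neg).hom⟩

/-- Duals `(A, B)* = (B, A)`; the unit `I ⊗ (A ⊗ B) ⟶ (A ⊗ B) ⊗ I` and the counit
`(B ⊗ A) ⊗ I ⟶ I ⊗ (B ⊗ A)` are identities in the strict case. -/
def intDual (C : Type u) [Category.{v} C] [MonoidalCategory C] [SymmetricCategory C] :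
    DualData (intTensor C) where
  dual A := ⟨A.neg, A.pos⟩
  η A := ⟨(λ_ (A.pos ⊗ A.neg)).hom ≫ (ρ_ (A.pos ⊗ A.neg)).inv⟩
  ε A := ⟨(ρ_ (A.neg ⊗ A.pos)).hom ≫ (λ_ (A.neg ⊗ A.pos)).inv⟩

/-- `N : C ⟶ Int^p(C)`, `N A = (A, I)` and `N f = f`, regarded as an arrow `A ⊗ I ⟶ B ⊗ I`. -/
def intN (C : Type u) [Category.{v} C] [MonoidalCategory C] : C ⥤q IntP C where
  obj A := ⟨A, 𝟙_ C⟩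
  map {A B} f := ⟨(ρ_ A).hom ≫ f ≫ (ρ_ B).inv⟩

/-- In the strict case `N (A ⊗ B) = N A ⊗ N B`. -/
theorem intN_tensor [StrictMonoidal C] (A B : C) :
    (intN C).obj (A ⊗ B) = (intTensor C).obj ((intN C).obj A) ((intN C).obj B) :=
  IntP.ext rfl (StrictMonoidal.unit_obj (𝟙_ C)).symm

end Int

end IntPara

/-!
The axioms of a partial trace are just what is needed to embed the partial operation `Tr` into a
total one. A *generalized arrow* from `X` to `Y` is an arrow `X ⊗ U ⟶ Y ⊗ U` of `C`, read as its
formal trace over `U`; two of them are identified when an arrow is slid along the feedback loop, and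
when a part `V` of the loop `U ⊗ V` over which the trace is defined is replaced by the value of that
trace (`PartialTrace.Gen`). On generalized arrows the trace is total. The
point of the construction is that evaluation by `Tr` respects the identifications, by dinaturality
and Vanishing II (`toPart`), and by Vanishing I recovers an arrow of `C` from its formal trace over
the unit object; hence arrows of `C` embed into generalized arrows (`ofHom_injective`), and `t` is
the partial trace of `f` if and only if the total trace of `f` is the generalized arrow `t`
(`mem_tr_iff`). Kleene equality and all questions of definedness thereby become equations between
generalized arrows.

Generalized arrows have a tensor product `par`, which is well defined by naturality and
superposing, and yanking straightens loops (`trace_yank`). So the usual Int construction applies to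
them: `comp` feeds both components of the middle pair back, it is associative (`comp_assoc`),
and it satisfies the interchange law (`comp_tens`). The total composite `pathGen` of a path is the
total trace of its pyramid (`pathGen_cons`, by induction on the path: prolonging the path by one
arrow adds one more strand to the pyramid and bends it back). Therefore the composite of a path in
`Int^p(C)` is defined, with value `g`, if and only if its total composite is `g`
(`mem_intComp_iff`), and each axiom of a strict symmetric monoidal compact closed paracategory
follows from the corresponding equation of a total category.

All of this rests on rearrangements of strands, which are settled by a coherence theorem for
symmetric monoidal categories (`coherence`): two composites of structural isomorphisms and
symmetries are equal when they induce the same permutation of the factors.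
-/

namespace IntPara

/-! ### Coherence for symmetric monoidal categories -/

section Coherence

variable {C : Type u} [Category.{v} C] [MonoidalCategory C]

/-- A bracketing of the object `X` as a tensor product of units and labelled objects. -/
inductive Tree : C → Type u
  | node {X Y : C} : Tree X → Tree Y → Tree (X ⊗ Y)
  | unit : Tree (𝟙_ C)
  | leaf (n : ℕ) (X : C) : Tree X

namespace Tree

/-- The labels of the leaves, from left to right. -/
def labels : ∀ {X : C}, Tree X → List ℕ
  | _, node s t => s.labels ++ t.labels
  | _, unit => []
  | _, leaf n _ => [n]

/-- The leaves of the bracketing are numbered `n, n + 1, …, m - 1` from left to right. -/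
inductive Numbered : ℕ → ℕ → ∀ {X : C}, Tree X → Prop
  | node {n m k : ℕ} {X Y : C} {s : Tree X} {t : Tree Y} :
      Numbered n m s → Numbered m k t → Numbered n k (node s t)
  | unit {n : ℕ} : Numbered n n unit
  | leaf {n : ℕ} {X : C} : Numbered n (n + 1) (leaf n X)

theorem Numbered.labels_eq {n m : ℕ} {X : C} {t : Tree X} (h : Numbered n m t) :
    n ≤ m ∧ t.labels = List.range' n (m - n) := by
  induction h with
  | @node n m k X Y s t _ _ ihs iht =>
    refine ⟨ihs.1.trans iht.1, ?_⟩
    have e : n + (m - n) = m := by have := ihs.1; omega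
    have e' : k - n = (m - n) + (k - m) := by have := ihs.1; have := iht.1; omega
    rw [labels, ihs.2, iht.2, e', ← List.range'_append_1, e]
  | unit => simp [labels]
  | leaf => simp [labels]

theorem Numbered.nodup {n m : ℕ} {X : C} {t : Tree X} (h : Numbered n m t) : t.labels.Nodup := by
  rw [h.labels_eq.2]; exact List.nodup_range' ..

/-- `t` has no leaves, and `c` is the canonical map to the unit object. -/
def Empty : ∀ {X : C}, Tree X → (X ⟶ 𝟙_ C) → Prop
  | _, node s t, c => ∃ c₁ c₂, Empty s c₁ ∧ Empty t c₂ ∧ c = (c₁ ⊗ₘ c₂) ≫ (λ_ _).hom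
  | _, unit, c => c = 𝟙 _
  | _, leaf _ _, _ => False

theorem Empty.node {X Y : C} {s : Tree X} {t : Tree Y} {c : X ⟶ 𝟙_ C} {d : Y ⟶ 𝟙_ C}
    (hc : Empty s c) (hd : Empty t d) : Empty (node s t) ((c ⊗ₘ d) ≫ (λ_ _).hom) :=
  ⟨c, d, hc, hd, rfl⟩

theorem Empty.unique {X : C} {t : Tree X} {c d : X ⟶ 𝟙_ C} (h : Empty t c) (h' : Empty t d) :
    c = d := by
  induction t with
  | unit => exact h.trans h'.symm
  | node s t ih₁ ih₂ =>
    obtain ⟨c₁, c₂, h₁, h₂, rfl⟩ := h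
    obtain ⟨d₁, d₂, h₁', h₂', rfl⟩ := h'
    rw [ih₁ h₁ h₁', ih₂ h₂ h₂']
  | leaf => exact h.elim

theorem Empty.isIso {X : C} {t : Tree X} {c : X ⟶ 𝟙_ C} (h : Empty t c) : IsIso c := by
  induction t with
  | unit => obtain rfl : c = 𝟙 _ := h; infer_instance
  | node s t ih₁ ih₂ =>
    obtain ⟨c₁, c₂, h₁, h₂, rfl⟩ := h
    have := ih₁ h₁
    have := ih₂ h₂
    infer_instance
  | leaf => exact h.elim

theorem Empty.labels_eq {X : C} {t : Tree X} {c : X ⟶ 𝟙_ C} (h : Empty t c) :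
    t.labels = [] := by
  induction t with
  | unit => rfl
  | node s t ih₁ ih₂ =>
    obtain ⟨c₁, c₂, h₁, h₂, rfl⟩ := h
    simp [labels, ih₁ h₁, ih₂ h₂]
  | leaf => exact h.elim

variable (X : C) in
/-- A factorization of the object `X`, up to a map, as a factor `obj` in front of a bracketed
object `rest`. -/
structure Extraction where
  obj : C
  rest : C
  tree : Tree rest
  hom : X ⟶ obj ⊗ rest

variable [SymmetricCategory C]

/-- `Extract a t E`: the factor `E.obj` is the leaf of `t` with label `a`, deleting this leaf leaves
the bracketing `E.tree`, and `E.hom` moves the leaf to the front. -/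
def Extract (a : ℕ) : ∀ {X : C}, Tree X → Extraction X → Prop
  | _, node (X := X) (Y := Y) s t, E =>
      (∃ A X₀ s₀ e, Extract a s ⟨A, X₀, s₀, e⟩ ∧
        E = ⟨A, X₀ ⊗ Y, node s₀ t, e ▷ Y ≫ (α_ A X₀ Y).hom⟩) ∨
      (∃ A Y₀ t₀ e, Extract a t ⟨A, Y₀, t₀, e⟩ ∧
        E = ⟨A, X ⊗ Y₀, node s t₀,
          X ◁ e ≫ (α_ X A Y₀).inv ≫ (β_ X A).hom ▷ Y₀ ≫ (α_ A X Y₀).hom⟩)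
  | _, unit, _ => False
  | _, leaf n X, E => n = a ∧ E = ⟨X, 𝟙_ C, unit, (ρ_ X).inv⟩

theorem Extract.left {a : ℕ} {A X X₀ Y : C} {s : Tree X} {s₀ : Tree X₀} {t : Tree Y}
    {e : X ⟶ A ⊗ X₀} (h : Extract a s ⟨A, X₀, s₀, e⟩) :
    Extract a (node s t) ⟨A, X₀ ⊗ Y, node s₀ t, e ▷ Y ≫ (α_ A X₀ Y).hom⟩ :=
  .inl ⟨_, _, _, _, h, rfl⟩

theorem Extract.right {a : ℕ} {A X Y Y₀ : C} {s : Tree X} {t : Tree Y} {t₀ : Tree Y₀}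
    {e : Y ⟶ A ⊗ Y₀} (h : Extract a t ⟨A, Y₀, t₀, e⟩) :
    Extract a (node s t) ⟨A, X ⊗ Y₀, node s t₀,
      X ◁ e ≫ (α_ X A Y₀).inv ≫ (β_ X A).hom ▷ Y₀ ≫ (α_ A X Y₀).hom⟩ :=
  .inr ⟨_, _, _, _, h, rfl⟩

theorem Extract.isIso {a : ℕ} {X : C} {t : Tree X} {E : Extraction X} (h : Extract a t E) :
    IsIso E.hom := by
  induction t with
  | node s t ih₁ ih₂ =>
    obtain ⟨A, X₀, s₀, e, h, rfl⟩ | ⟨A, X₀, s₀, e, h, rfl⟩ := h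
    · have : IsIso e := ih₁ h
      dsimp only; infer_instance
    · have : IsIso e := ih₂ h
      dsimp only; infer_instance
  | unit => exact h.elim
  | leaf => obtain ⟨-, rfl⟩ := h; dsimp only; infer_instance

theorem Extract.labels_perm {a : ℕ} {X : C} {t : Tree X} {E : Extraction X} (h : Extract a t E) :
    t.labels.Perm (a :: E.tree.labels) := by
  induction t with
  | node s t ih₁ ih₂ =>
    obtain ⟨A, X₀, s₀, e, h, rfl⟩ | ⟨A, X₀, s₀, e, h, rfl⟩ := h
    · simpa [labels] using (ih₁ h).append_right _
    · simp only [labels]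
      exact ((ih₂ h).append_left _).trans List.perm_middle
  | unit => exact h.elim
  | leaf => obtain ⟨rfl, rfl⟩ := h; simp [labels]

theorem Extract.mem {a : ℕ} {X : C} {t : Tree X} {E : Extraction X} (h : Extract a t E) :
    a ∈ t.labels :=
  h.labels_perm.mem_iff.2 (by simp)

theorem Extract.unique {a : ℕ} {X : C} {t : Tree X} {E E' : Extraction X} (h : Extract a t E)
    (h' : Extract a t E') (hn : t.labels.Nodup) : E = E' := by
  induction t with
  | node s t ih₁ ih₂ =>
    rw [labels, List.nodup_append'] at hn
    obtain ⟨A, X₀, s₀, e, h, rfl⟩ | ⟨A, X₀, s₀, e, h, rfl⟩ := h <;>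
    obtain ⟨A', X₀', s₀', e', h', rfl⟩ | ⟨A', X₀', s₀', e', h', rfl⟩ := h'
    · cases ih₁ h h' hn.1; rfl
    · exact absurd h'.mem (hn.2.2 h.mem)
    · exact absurd h.mem (hn.2.2 h'.mem)
    · cases ih₂ h h' hn.2.1; rfl
  | unit => exact h.elim
  | leaf => exact h.2.trans h'.2.symm

theorem empty_or_extract {X : C} (t : Tree X) :
    (∃ c, Empty t c) ∨ ∃ (a : ℕ) (E : Extraction X), Extract a t E := by
  induction t with
  | node s t ihs iht =>
    rcases ihs with ⟨c, hc⟩ | ⟨a, E, h⟩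
    · rcases iht with ⟨d, hd⟩ | ⟨a, E, h⟩
      · exact .inl ⟨_, hc.node hd⟩
      · exact .inr ⟨a, _, h.right⟩
    · exact .inr ⟨a, _, h.left⟩
  | unit => exact .inl ⟨_, rfl⟩
  | leaf n X => exact .inr ⟨n, _, rfl, rfl⟩

end Tree

open IntPara.Tree

variable [SymmetricCategory C]

/-- `f` is a composite of structural isomorphisms and symmetries that takes the leaves of `s` to
the leaves of `t` with the same label. -/
inductive Structural : ∀ {X Y : C}, Tree X → Tree Y → (X ⟶ Y) → Prop
  | comp {X Y Z : C} {s : Tree X} {t : Tree Y} {r : Tree Z} {f : X ⟶ Y} {g : Y ⟶ Z} :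
      Structural s t f → Structural t r g → Structural s r (f ≫ g)
  | whiskerLeft {X Y Z : C} {r : Tree X} {s : Tree Y} {t : Tree Z} {f : Y ⟶ Z} :
      Structural s t f → Structural (node r s) (node r t) (X ◁ f)
  | whiskerRight {X Y Z : C} {r : Tree X} {s : Tree Y} {t : Tree Z} {f : Y ⟶ Z} :
      Structural s t f → Structural (node s r) (node t r) (f ▷ X)
  | tensor {X Y X' Y' : C} {s : Tree X} {t : Tree Y} {s' : Tree X'} {t' : Tree Y'}
      {f : X ⟶ Y} {g : X' ⟶ Y'} :
      Structural s t f → Structural s' t' g → Structural (node s s') (node t t') (f ⊗ₘ g)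
  | id {X : C} {t : Tree X} : Structural t t (𝟙 X)
  | assoc {X Y Z : C} {r : Tree X} {s : Tree Y} {t : Tree Z} :
      Structural (node (node r s) t) (node r (node s t)) (α_ X Y Z).hom
  | assoc_inv {X Y Z : C} {r : Tree X} {s : Tree Y} {t : Tree Z} :
      Structural (node r (node s t)) (node (node r s) t) (α_ X Y Z).inv
  | leftUnitor {X : C} {t : Tree X} : Structural (node unit t) t (λ_ X).hom
  | leftUnitor_inv {X : C} {t : Tree X} : Structural t (node unit t) (λ_ X).inv
  | rightUnitor {X : C} {t : Tree X} : Structural (node t unit) t (ρ_ X).hom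
  | rightUnitor_inv {X : C} {t : Tree X} : Structural t (node t unit) (ρ_ X).inv
  | braiding {X Y : C} {s : Tree X} {t : Tree Y} : Structural (node s t) (node t s) (β_ X Y).hom

namespace Structural

theorem labels_perm {X Y : C} {s : Tree X} {t : Tree Y} {f : X ⟶ Y} (h : Structural s t f) :
    s.labels.Perm t.labels := by
  induction h with
  | comp _ _ ih₁ ih₂ => exact ih₁.trans ih₂
  | whiskerLeft _ ih => exact ih.append_left _
  | whiskerRight _ ih => exact ih.append_right _
  | tensor _ _ ih₁ ih₂ => exact ih₁.append ih₂
  | braiding => exact List.perm_append_comm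
  | _ => simp [labels]

/-- A structural map between bracketings without leaves commutes with the maps to the unit. -/
theorem empty {X Y : C} {s : Tree X} {t : Tree Y} {f : X ⟶ Y} (h : Structural s t f)
    {c : X ⟶ 𝟙_ C} (hc : Empty s c) : ∃ d, Empty t d ∧ f ≫ d = c := by
  induction h with
  | comp _ _ ih₁ ih₂ =>
    obtain ⟨d, hd, rfl⟩ := ih₁ hc
    obtain ⟨d', hd', rfl⟩ := ih₂ hd
    exact ⟨d', hd', by simp⟩
  | whiskerLeft _ ih =>
    obtain ⟨_, _, h₁, h₂, rfl⟩ := hc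
    obtain ⟨d, hd, rfl⟩ := ih h₂
    exact ⟨_, h₁.node hd, by
      simp [MonoidalCategory.tensorHom_def, whisker_exchange_assoc]⟩
  | whiskerRight _ ih =>
    obtain ⟨_, _, h₁, h₂, rfl⟩ := hc
    obtain ⟨d, hd, rfl⟩ := ih h₁
    exact ⟨_, hd.node h₂, by simp [MonoidalCategory.tensorHom_def]⟩
  | tensor _ _ ih₁ ih₂ =>
    obtain ⟨_, _, h₁, h₂, rfl⟩ := hc
    obtain ⟨d, hd, rfl⟩ := ih₁ h₁
    obtain ⟨d', hd', rfl⟩ := ih₂ h₂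
    exact ⟨_, hd.node hd', by simp⟩
  | id => exact ⟨_, hc, by simp⟩
  | assoc =>
    obtain ⟨_, _, ⟨_, _, h₁, h₂, rfl⟩, h₃, rfl⟩ := hc
    exact ⟨_, h₁.node (h₂.node h₃), by simp [MonoidalCategory.tensorHom_def]⟩
  | assoc_inv =>
    obtain ⟨_, _, h₁, ⟨_, _, h₂, h₃, rfl⟩, rfl⟩ := hc
    exact ⟨_, (h₁.node h₂).node h₃, by simp [MonoidalCategory.tensorHom_def]⟩
  | leftUnitor =>
    obtain ⟨_, _, rfl, h₂, rfl⟩ := hc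
    exact ⟨_, h₂, by simp [MonoidalCategory.tensorHom_def]⟩
  | leftUnitor_inv => exact ⟨_, .node (s := unit) (c := 𝟙 _) rfl hc, by
      simp [MonoidalCategory.tensorHom_def]⟩
  | rightUnitor =>
    obtain ⟨_, _, h₂, rfl, rfl⟩ := hc
    exact ⟨_, h₂, by
      simp [MonoidalCategory.tensorHom_def, unitors_equal]⟩
  | rightUnitor_inv => exact ⟨_, .node (t := unit) (d := 𝟙 _) hc rfl, by
      simp [MonoidalCategory.tensorHom_def, unitors_equal]⟩
  | braiding =>
    obtain ⟨_, _, h₁, h₂, rfl⟩ := hc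
    exact ⟨_, h₂.node h₁, by
      rw [← BraidedCategory.braiding_naturality_assoc]
      simp [unitors_equal, unitors_inv_equal]⟩

/-- A structural map carries each leaf along: it restricts to the complement of a leaf. -/
theorem extract {X Y : C} {s : Tree X} {t : Tree Y} {f : X ⟶ Y} (h : Structural s t f)
    {a : ℕ} {A X₀ : C} {s₀ : Tree X₀} {e : X ⟶ A ⊗ X₀} (he : Extract a s ⟨A, X₀, s₀, e⟩) :
    ∃ (Y₀ : C) (t₀ : Tree Y₀) (e' : Y ⟶ A ⊗ Y₀) (f₀ : X₀ ⟶ Y₀),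
      Extract a t ⟨A, Y₀, t₀, e'⟩ ∧ Structural s₀ t₀ f₀ ∧ f ≫ e' = e ≫ A ◁ f₀ := by
  induction h generalizing X₀ with
  | comp _ _ ih₁ ih₂ =>
    obtain ⟨_, _, e₁, f₁, he₁, hf₁, h₁⟩ := ih₁ he
    obtain ⟨_, _, e₂, f₂, he₂, hf₂, h₂⟩ := ih₂ he₁
    exact ⟨_, _, e₂, f₁ ≫ f₂, he₂, hf₁.comp hf₂, by simp [h₂, reassoc_of% h₁]⟩
  | whiskerLeft hf ih =>
    obtain ⟨_, _, _, _, he, h⟩ | ⟨_, _, _, _, he, h⟩ := he <;> cases h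
    · exact ⟨_, _, _, _, he.left, hf.whiskerLeft, by
        rw [whisker_exchange_assoc]; simp⟩
    · obtain ⟨_, _, e₁, f₁, he₁, hf₁, h₁⟩ := ih he
      refine ⟨_, _, _, _, he₁.right, hf₁.whiskerLeft, ?_⟩
      rw [← whiskerLeft_comp_assoc, h₁]
      rw [whiskerLeft_comp_assoc, associator_inv_naturality_right_assoc, whisker_exchange_assoc]
      simp
  | whiskerRight hf ih =>
    obtain ⟨_, _, _, _, he, h⟩ | ⟨_, _, _, _, he, h⟩ := he <;> cases h
    · obtain ⟨_, _, e₁, f₁, he₁, hf₁, h₁⟩ := ih he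
      refine ⟨_, _, _, _, he₁.left, hf₁.whiskerRight, ?_⟩
      rw [← comp_whiskerRight_assoc, h₁]
      simp
    · refine ⟨_, _, _, _, he.right, hf.whiskerRight, ?_⟩
      rw [← whisker_exchange_assoc]
      simp [← comp_whiskerRight_assoc]
  | tensor hf hg ih₁ ih₂ =>
    obtain ⟨_, _, _, _, he, h⟩ | ⟨_, _, _, _, he, h⟩ := he <;> cases h
    · obtain ⟨_, _, e₁, f₁, he₁, hf₁, h₁⟩ := ih₁ he
      refine ⟨_, _, _, _, he₁.left, hf₁.tensor hg, ?_⟩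
      rw [MonoidalCategory.tensorHom_def', Category.assoc, ← comp_whiskerRight_assoc, h₁,
        MonoidalCategory.tensorHom_def']
      simp [whisker_exchange_assoc]
    · obtain ⟨_, _, e₁, f₁, he₁, hf₁, h₁⟩ := ih₂ he
      refine ⟨_, _, _, _, he₁.right, hf.tensor hf₁, ?_⟩
      rw [MonoidalCategory.tensorHom_def, Category.assoc, ← whiskerLeft_comp_assoc, h₁,
        MonoidalCategory.tensorHom_def]
      rw [whiskerLeft_comp_assoc, associator_inv_naturality_right_assoc, whisker_exchange_assoc,
        ← whisker_exchange_assoc, associator_inv_naturality_left_assoc, ← comp_whiskerRight_assoc,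
        BraidedCategory.braiding_naturality_left, comp_whiskerRight_assoc]
      simp
  | id => exact ⟨_, _, _, _, he, .id, by simp⟩
  | assoc =>
    obtain ⟨_, _, _, _, ⟨_, _, _, _, he, h⟩ | ⟨_, _, _, _, he, h⟩, h'⟩ |
      ⟨_, _, _, _, he, h⟩ := he <;>
      cases h <;> try cases h'
    · exact ⟨_, _, _, _, he.left, .assoc, by simp⟩
    · exact ⟨_, _, _, _, he.left.right, .assoc, by simp⟩
    · exact ⟨_, _, _, _, he.right.right, .assoc, by simp⟩
  | assoc_inv =>
    obtain ⟨_, _, _, _, he, h⟩ |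
      ⟨_, _, _, _, ⟨_, _, _, _, he, h⟩ | ⟨_, _, _, _, he, h⟩, h'⟩ := he <;>
      cases h <;> try cases h'
    · exact ⟨_, _, _, _, he.left.left, .assoc_inv, by simp⟩
    · exact ⟨_, _, _, _, he.right.left, .assoc_inv, by simp⟩
    · exact ⟨_, _, _, _, he.right, .assoc_inv, by simp⟩
  | leftUnitor =>
    obtain ⟨_, _, _, _, he, h⟩ | ⟨_, _, _, _, he, h⟩ := he
    · exact he.elim
    · cases h
      exact ⟨_, _, _, _, he, .leftUnitor, by simp⟩
  | leftUnitor_inv => exact ⟨_, _, _, _, he.right, .leftUnitor_inv, by simp⟩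
  | rightUnitor =>
    obtain ⟨_, _, _, _, he, h⟩ | ⟨_, _, _, _, he, h⟩ := he
    · cases h
      exact ⟨_, _, _, _, he, .rightUnitor, by simp⟩
    · exact he.elim
  | rightUnitor_inv => exact ⟨_, _, _, _, he.left, .rightUnitor_inv, by simp⟩
  | braiding =>
    obtain ⟨_, _, _, _, he, h⟩ | ⟨_, _, _, _, he, h⟩ := he <;> cases h
    · exact ⟨_, _, _, _, he.right, .braiding, by
        rw [← BraidedCategory.braiding_naturality_left_assoc,
          BraidedCategory.braiding_tensor_left_hom]
        simp [← comp_whiskerRight_assoc]⟩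
    · exact ⟨_, _, _, _, he.left, .braiding, by
        rw [← BraidedCategory.braiding_naturality_right_assoc,
          BraidedCategory.braiding_tensor_right_hom]
        simp⟩

end Structural

/-- The leaves are split off one after the other, in the source and, along `f` and `g`, in the
target; a map between products without leaves is determined by the maps to the unit. -/
theorem Structural.eq_of_nodup {X Y : C} {s : Tree X} {t : Tree Y} {f g : X ⟶ Y}
    (hf : Structural s t f) (hg : Structural s t g) (hs : s.labels.Nodup) : f = g := by
  induction hn : s.labels.length generalizing X Y with
  | zero =>
    rcases s.empty_or_extract with ⟨c, hc⟩ | ⟨a, E, he⟩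
    · obtain ⟨d, hd, h⟩ := hf.empty hc
      obtain ⟨d', hd', h'⟩ := hg.empty hc
      obtain rfl := hd.unique hd'
      have := hd.isIso
      rw [← cancel_mono d, h, h']
    · simp [he.labels_perm.length_eq] at hn
  | succ n ih =>
    rcases s.empty_or_extract with ⟨c, hc⟩ | ⟨a, E, he⟩
    · simp [hc.labels_eq] at hn
    · obtain ⟨Y₁, t₁, e₁, f₁, he₁, hf₁, h₁⟩ := hf.extract he
      obtain ⟨Y₂, t₂, e₂, f₂, he₂, hf₂, h₂⟩ := hg.extract he
      have : IsIso e₁ := he₁.isIso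
      cases he₁.unique he₂ (hf.labels_perm.nodup_iff.1 hs)
      have hl := he.labels_perm
      have : f₁ = f₂ := ih hf₁ hf₂ (hl.nodup_iff.1 hs).of_cons
        (by have := hl.length_eq; simp at this; omega)
      rw [← cancel_mono e₁, h₁, h₂, this]

/-- Coherence: two structural maps inducing the same permutation of the factors are equal.

In applications the bracketings are left to unification. `repeat' constructor` first numbers the
factors of the source that are neither tensor products nor units, and then computes the bracketing
of the target from `f`; that the derivation for `g` ends in the same bracketing is the check that
the permutations agree. -/
theorem coherence {X Y : C} {m : ℕ} {s : Tree X} {t : Tree Y} {f g : X ⟶ Y}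
    (hs : Numbered 0 m s) (hf : Structural s t f) (hg : Structural s t g) : f = g :=
  hf.eq_of_nodup hg hs.nodup

end Coherence
end IntPara

namespace IntPara

/-! ### Arrows among structural maps -/

section Around

variable {C : Type u} [Category.{v} C]

/-- `F` is the arrow `f` preceded by `a` and followed by `b`. -/
inductive Around {P Q : C} (f : P ⟶ Q) : ∀ {X Y : C}, (X ⟶ P) → (Q ⟶ Y) → (X ⟶ Y) → Prop
  | here {Y : C} {b : Q ⟶ Y} : Around f (𝟙 P) b (f ≫ b)
  | pre {X X' Y : C} {s : X ⟶ X'} {a : X' ⟶ P} {b : Q ⟶ Y} {F : X' ⟶ Y} :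
      Around f a b F → Around f (s ≫ a) b (s ≫ F)

theorem Around.eq {P Q X Y : C} {f : P ⟶ Q} {a : X ⟶ P} {b : Q ⟶ Y} {F : X ⟶ Y}
    (h : Around f a b F) : F = a ≫ f ≫ b := by
  induction h <;> simp_all

variable [MonoidalCategory C] {X Y X' Y' X'' Y'' : C}

/-- Isolates an arrow `f` between two structural maps inside a tensor product. -/
theorem tensorHom_split_left (a : X'' ⟶ X) (f : X ⟶ Y) (b : Y ⟶ Y'') (g : X' ⟶ Y') :
    ((a ≫ f ≫ b) ⊗ₘ g) = a ▷ X' ≫ (f ⊗ₘ g) ≫ b ▷ Y' := by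
  simp only [← tensorHom_id, tensorHom_comp_tensorHom, Category.id_comp, Category.comp_id]

theorem tensorHom_split_right (a : X'' ⟶ X) (f : X ⟶ Y) (b : Y ⟶ Y'') (g : X' ⟶ Y') :
    (g ⊗ₘ (a ≫ f ≫ b)) = X' ◁ a ≫ (g ⊗ₘ f) ≫ Y' ◁ b := by
  simp only [← id_tensorHom, tensorHom_comp_tensorHom, Category.id_comp, Category.comp_id]

variable [SymmetricCategory C]

theorem tensorHom_swap (f : X ⟶ Y) (g : X' ⟶ Y') :
    (f ⊗ₘ g) = (β_ X X').hom ≫ (g ⊗ₘ f) ≫ (β_ Y' Y).hom := by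
  rw [← BraidedCategory.braiding_naturality_assoc, SymmetricCategory.symmetry, Category.comp_id]

/-- Coherence for two composites of structural maps with one arrow `f`. -/
theorem around_coherence {P Q : C} (f : P ⟶ Q) {a a' : X ⟶ P} {b b' : Q ⟶ Y} {F F' : X ⟶ Y}
    {m n : ℕ} {s : Tree X} {t : Tree P} {r : Tree Q} {w : Tree Y}
    (hF : Around f a b F) (hF' : Around f a' b' F')
    (hs : s.Numbered 0 m) (ha : Structural s t a) (ha' : Structural s t a')
    (hr : r.Numbered 0 n) (hb : Structural r w b) (hb' : Structural r w b') : F = F' := by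
  rw [hF.eq, hF'.eq, coherence hs ha ha', coherence hr hb hb']

/-- Coherence for two composites of structural maps with an arrow `f` followed by an arrow `g`. -/
theorem around_coherence₂ {P Q P' Q' : C} (f : P ⟶ Q) (g : P' ⟶ Q') {a a' : X ⟶ P} {b b' : Q ⟶ Y}
    {c c' : Q ⟶ P'} {d d' : Q' ⟶ Y} {F F' : X ⟶ Y} {m n : ℕ} {s : Tree X} {t : Tree P}
    {r : Tree Q} {w : Tree P'} {k : ℕ} {r' : Tree Q'} {w' : Tree Y}
    (hF : Around f a b F) (hF' : Around f a' b' F') (hG : Around g c d b)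
    (hG' : Around g c' d' b') (hs : s.Numbered 0 m) (ha : Structural s t a)
    (ha' : Structural s t a') (hr : r.Numbered 0 n) (hc : Structural r w c)
    (hc' : Structural r w c') (hr' : r'.Numbered 0 k) (hd : Structural r' w' d)
    (hd' : Structural r' w' d') : F = F' := by
  rw [hF.eq, hF'.eq, hG.eq, hG'.eq, coherence hs ha ha', coherence hr hc hc',
    coherence hr' hd hd']

end Around

/-! ### Generalized arrows: a total trace containing the partial one -/

namespace PartialTrace

variable {C : Type u} [Category.{v} C] [MonoidalCategory C] [SymmetricCategory C]

/-- The relation generating the equality of generalized arrows: an arrow may slide along the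
feedback loop, and a loop whose trace is defined may be replaced by the trace. -/
inductive LoopRel (T : PartialTrace C) (X Y : C) :
    (Σ U : C, (X ⊗ U ⟶ Y ⊗ U)) → (Σ U : C, (X ⊗ U ⟶ Y ⊗ U)) → Prop
  | slide {U U' : C} (f : X ⊗ U ⟶ Y ⊗ U') (g : U' ⟶ U) :
      LoopRel T X Y ⟨U, f ≫ Y ◁ g⟩ ⟨U', X ◁ g ≫ f⟩
  | hide {U V : C} (g : (X ⊗ U) ⊗ V ⟶ (Y ⊗ U) ⊗ V) (t : X ⊗ U ⟶ Y ⊗ U) (h : t ∈ T.tr V g) :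
      LoopRel T X Y ⟨U ⊗ V, (α_ X U V).inv ≫ g ≫ (α_ Y U V).hom⟩ ⟨U, t⟩

/-- Generalized arrows from `X` to `Y`: arrows `X ⊗ U ⟶ Y ⊗ U`, thought of as the formal trace
over `U`, modulo `LoopRel`. -/
def Gen (T : PartialTrace C) (X Y : C) : Type max u v := Quot (T.LoopRel X Y)

namespace Gen

variable {T : PartialTrace C} {X Y X' Y' X'' Y'' : C}

/-- The formal trace of `m` over `U`. -/
def mk (T : PartialTrace C) (U : C) (m : X ⊗ U ⟶ Y ⊗ U) : Gen T X Y := Quot.mk _ ⟨U, m⟩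

theorem slide {U U' : C} (f : X ⊗ U ⟶ Y ⊗ U') (g : U' ⟶ U) :
    mk T U (f ≫ Y ◁ g) = mk T U' (X ◁ g ≫ f) :=
  Quot.sound (.slide f g)

theorem exists_rep (q : Gen T X Y) : ∃ (U : C) (m : X ⊗ U ⟶ Y ⊗ U), q = mk T U m := by
  obtain ⟨U, m⟩ := q
  exact ⟨U, m, rfl⟩

theorem hide {U V : C} (g : (X ⊗ U) ⊗ V ⟶ (Y ⊗ U) ⊗ V) {t : X ⊗ U ⟶ Y ⊗ U} (h : t ∈ T.tr V g) :
    mk T (U ⊗ V) ((α_ X U V).inv ≫ g ≫ (α_ Y U V).hom) = mk T U t :=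
  Quot.sound (.hide g t h)

/-- Isomorphic loops give the same generalized arrow. -/
theorem mk_iso {U U' : C} (e : U ≅ U') {m : X ⊗ U ⟶ Y ⊗ U} {m' : X ⊗ U' ⟶ Y ⊗ U'}
    (h : m ≫ Y ◁ e.hom = X ◁ e.hom ≫ m') : mk T U m = mk T U' m' := by
  have h₁ := slide (T := T) (m ≫ Y ◁ e.hom) e.inv
  have h₂ : X ◁ e.inv ≫ m ≫ Y ◁ e.hom = m' := by simp [h]
  rw [h₂] at h₁
  simpa using h₁

/-- Composition with arrows of `C` on both sides. -/
def conj (a : X' ⟶ X) (b : Y ⟶ Y') (q : Gen T X Y) : Gen T X' Y' :=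
  Quot.lift (fun p => mk T p.1 (a ▷ p.1 ≫ p.2 ≫ b ▷ p.1)) (by
    rintro _ _ (⟨f, g⟩ | ⟨g, t, h⟩)
    · have := slide (T := T) (a ▷ _ ≫ f ≫ b ▷ _) g
      simp only [Category.assoc, whisker_exchange, whisker_exchange_assoc] at this ⊢
      rw [← this]
    · dsimp only
      rw [← hide _ (T.naturality _ (a ▷ _) (b ▷ _) _ h)]
      simp) q

/-- The trace of generalized arrows, which is total. -/
def trace (V : C) (q : Gen T (X ⊗ V) (Y ⊗ V)) : Gen T X Y :=
  Quot.lift (fun p => mk T (V ⊗ p.1) ((α_ X V p.1).inv ≫ p.2 ≫ (α_ Y V p.1).hom)) (by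
    rintro _ _ (⟨f, g⟩ | ⟨g, t, h⟩)
    · have := slide (T := T) ((α_ _ _ _).inv ≫ f ≫ (α_ _ _ _).hom) (V ◁ g)
      simpa using this
    · dsimp only
      rw [← hide _ (T.naturality _ (α_ _ _ _).inv (α_ _ _ _).hom _ h)]
      refine mk_iso (α_ _ _ _).symm ?_
      simp only [Category.assoc]
      apply around_coherence g <;> repeat' constructor) q

/-- An arrow of `C`, as a generalized arrow. -/
def ofHom (T : PartialTrace C) (f : X ⟶ Y) : Gen T X Y := mk T (𝟙_ C) (f ▷ 𝟙_ C)

/-- The value of a generalized arrow under the partial trace. -/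
def toPart (q : Gen T X Y) : Part (X ⟶ Y) :=
  Quot.lift (fun p => T.tr p.1 p.2) (by
    rintro _ _ (⟨f, g⟩ | ⟨g, t, h⟩)
    · exact T.dinaturality f g
    · exact T.vanishing_two g t h) q

theorem toPart_ofHom (f : X ⟶ Y) : (ofHom T f).toPart = Part.some f :=
  (T.vanishing_one _).trans (by simp)

theorem trace_ofHom_eq_mk (U : C) (m : X ⊗ U ⟶ Y ⊗ U) : trace U (ofHom T m) = mk T U m := by
  refine mk_iso (ρ_ U) ?_
  simp

theorem trace_ofHom {U : C} {f : X ⊗ U ⟶ Y ⊗ U} {t : X ⟶ Y} (h : t ∈ T.tr U f) :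
    trace U (ofHom T f) = ofHom T t := by
  rw [trace_ofHom_eq_mk]
  have := hide _ (T.naturality _ (ρ_ X).hom (ρ_ Y).inv _ h)
  rw [ofHom, whiskerRight_id, ← this]
  refine mk_iso (λ_ U).symm ?_
  simp only [Category.assoc]
  apply around_coherence f <;> repeat' constructor

/-- The partial trace is the restriction of the total trace: it is defined precisely when the
total trace of an arrow of `C` is again an arrow of `C`. -/
theorem mem_tr_iff {U : C} {f : X ⊗ U ⟶ Y ⊗ U} {t : X ⟶ Y} :
    t ∈ T.tr U f ↔ trace U (ofHom T f) = ofHom T t := by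
  refine ⟨trace_ofHom, fun h => ?_⟩
  have h' : T.tr U f = (trace U (ofHom T f)).toPart := by rw [trace_ofHom_eq_mk]; rfl
  rw [h', h, toPart_ofHom]
  exact Part.mem_some _

/-- No arrows of `C` are identified, since evaluation by the partial trace separates them. -/
theorem ofHom_injective : Function.Injective (ofHom T : (X ⟶ Y) → Gen T X Y) := fun f g h => by
  have := congrArg toPart h
  rwa [toPart_ofHom, toPart_ofHom, Part.some_inj] at this

/-- The tensor product respects the replacement of a loop by its trace; this is superposing, with
the other factor carrying its own loop `V`. -/
theorem hide_tensor {U V W : C} {g : (X ⊗ U) ⊗ W ⟶ (Y ⊗ U) ⊗ W} {t : X ⊗ U ⟶ Y ⊗ U}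
    (h : t ∈ T.tr W g) (n : X' ⊗ V ⟶ Y' ⊗ V) :
    mk T ((U ⊗ W) ⊗ V) (tensorμ X X' (U ⊗ W) V ≫
      (((α_ X U W).inv ≫ g ≫ (α_ Y U W).hom) ⊗ₘ n) ≫ tensorμ Y (U ⊗ W) Y' V) =
    mk T (U ⊗ V) (tensorμ X X' U V ≫ (t ⊗ₘ n) ≫ tensorμ Y U Y' V) := by
  have h₁ := T.naturality _ (tensorμ X X' U V ≫ (β_ _ _).hom) ((β_ _ _).hom ≫ tensorμ Y U Y' V) _
    (T.superposing g n t h)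
  have h₂ : (tensorμ X X' U V ≫ (β_ _ _).hom) ≫ (n ⊗ₘ t) ≫ (β_ _ _).hom ≫ tensorμ Y U Y' V =
      tensorμ X X' U V ≫ (t ⊗ₘ n) ≫ tensorμ Y U Y' V := by
    rw [tensorHom_swap t n]
    simp only [Category.assoc]
  rw [h₂] at h₁
  rw [← hide _ h₁, tensorHom_swap n g, tensorHom_split_left]
  refine mk_iso (α_ _ _ _ ≪≫ whiskerLeftIso _ (β_ _ _) ≪≫ (α_ _ _ _).symm) ?_
  simp only [Category.assoc]
  apply around_coherence (g ⊗ₘ n) <;> repeat' constructor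

theorem slide_tensor {U U' V : C} (f : X ⊗ U ⟶ Y ⊗ U') (g : U' ⟶ U) (n : X' ⊗ V ⟶ Y' ⊗ V) :
    mk T (U ⊗ V) (tensorμ X X' U V ≫ ((f ≫ Y ◁ g) ⊗ₘ n) ≫ tensorμ Y U Y' V) =
    mk T (U' ⊗ V) (tensorμ X X' U' V ≫ ((X ◁ g ≫ f) ⊗ₘ n) ≫ tensorμ Y U' Y' V) := by
  have h₁ := slide (T := T) (tensorμ X X' U V ≫ (f ⊗ₘ n) ≫ tensorμ Y U' Y' V) (g ▷ V)
  have h₂ := tensorμ_natural (𝟙 Y) g (𝟙 Y') (𝟙 V)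
  have h₃ := tensorμ_natural_right X X' g (𝟙 V)
  have h₄ := tensorHom_split_left (𝟙 _) f (Y ◁ g) n
  have h₅ := tensorHom_split_left (X ◁ g) f (𝟙 _) n
  simp only [id_tensorHom, tensorHom_id, whiskerLeft_id, id_whiskerRight, Category.id_comp,
    Category.comp_id, Category.assoc] at h₁ h₂ h₃ h₄ h₅ ⊢
  rw [h₄, h₅, Category.assoc, h₂, h₁, reassoc_of% h₃, Category.assoc]

theorem mk_tensor_swap {U V : C} (m : X ⊗ U ⟶ Y ⊗ U) (n : X' ⊗ V ⟶ Y' ⊗ V) :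
    mk T (U ⊗ V) (tensorμ X X' U V ≫ (m ⊗ₘ n) ≫ tensorμ Y U Y' V) =
    conj (β_ X X').hom (β_ Y' Y).hom
      (mk T (V ⊗ U) (tensorμ X' X V U ≫ (n ⊗ₘ m) ≫ tensorμ Y' V Y U)) := by
  refine mk_iso (β_ _ _) ?_
  rw [tensorHom_swap m n]
  simp only [Category.assoc]
  apply around_coherence (n ⊗ₘ m) <;> repeat' constructor

/-- The tensor product of generalized arrows. -/
def par (q : Gen T X Y) (r : Gen T X' Y') : Gen T (X ⊗ X') (Y ⊗ Y') :=
  Quot.lift₂ (fun p p' => mk T (p.1 ⊗ p'.1)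
      (tensorμ X X' p.1 p'.1 ≫ (p.2 ⊗ₘ p'.2) ≫ tensorμ Y p.1 Y' p'.1))
    (by
      rintro ⟨V, n⟩ _ _ (⟨f, g⟩ | ⟨g, t, h⟩)
      · simp only [mk_tensor_swap n, slide_tensor]
      · simp only [mk_tensor_swap n, hide_tensor h])
    (by
      rintro _ _ ⟨V, n⟩ (⟨f, g⟩ | ⟨g, t, h⟩)
      · exact slide_tensor f g n
      · exact hide_tensor h n) q r

theorem conj_conj (a : X' ⟶ X) (b : Y ⟶ Y') (a' : X'' ⟶ X') (b' : Y' ⟶ Y'') (q : Gen T X Y) :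
    conj a' b' (conj a b q) = conj (a' ≫ a) (b ≫ b') q := by
  obtain ⟨U, m, rfl⟩ := q.exists_rep
  exact congrArg (mk T U) (by simp)

theorem conj_id (q : Gen T X Y) : conj (𝟙 X) (𝟙 Y) q = q := by
  obtain ⟨U, m, rfl⟩ := q.exists_rep
  exact congrArg (mk T U) (by simp)

theorem conj_ofHom (a : X' ⟶ X) (b : Y ⟶ Y') (f : X ⟶ Y) :
    conj a b (ofHom T f) = ofHom T (a ≫ f ≫ b) :=
  congrArg (mk T (𝟙_ C)) (by simp)

theorem conj_trace {V : C} (a : X' ⟶ X) (b : Y ⟶ Y') (q : Gen T (X ⊗ V) (Y ⊗ V)) :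
    conj a b (trace V q) = trace V (conj (a ▷ V) (b ▷ V) q) := by
  obtain ⟨U, m, rfl⟩ := q.exists_rep
  exact congrArg (mk T (V ⊗ U)) (by simp)

/-- The second vanishing axiom of the total trace. -/
theorem trace_trace {U V : C} (q : Gen T ((X ⊗ U) ⊗ V) ((Y ⊗ U) ⊗ V)) :
    trace U (trace V q) = trace (U ⊗ V) (conj (α_ X U V).inv (α_ Y U V).hom q) := by
  obtain ⟨W, m, rfl⟩ := q.exists_rep
  refine mk_iso (α_ _ _ _).symm ?_
  simp only [Category.assoc]
  apply around_coherence m <;> repeat' constructor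

/-- The dinaturality of the total trace. -/
theorem trace_slide {U U' : C} (g : U' ⟶ U) (q : Gen T (X ⊗ U) (Y ⊗ U')) :
    trace U (conj (𝟙 _) (Y ◁ g) q) = trace U' (conj (X ◁ g) (𝟙 _) q) := by
  obtain ⟨W, m, rfl⟩ := q.exists_rep
  have := slide (T := T) ((α_ X U W).inv ≫ m ≫ (α_ Y U' W).hom) (g ▷ W)
  refine Eq.trans (congrArg (mk T (U ⊗ W)) ?_) (this.trans (congrArg (mk T (U' ⊗ W)) ?_)) <;> simp

theorem par_conj_left (a : X'' ⟶ X) (b : Y ⟶ Y'') (q : Gen T X Y) (r : Gen T X' Y') :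
    par (conj a b q) r = conj (a ▷ X') (b ▷ Y') (par q r) := by
  obtain ⟨U, m, rfl⟩ := q.exists_rep
  obtain ⟨V, n, rfl⟩ := r.exists_rep
  have h₁ := tensorμ_natural a (𝟙 X') (𝟙 U) (𝟙 V)
  have h₂ := tensorμ_natural b (𝟙 U) (𝟙 Y') (𝟙 V)
  simp only [tensorHom_id, id_whiskerRight] at h₁ h₂
  refine congrArg (mk T (U ⊗ V)) ?_
  rw [tensorHom_split_left, Category.assoc, Category.assoc, Category.assoc, Category.assoc, h₂,
    reassoc_of% h₁]

theorem par_comm (q : Gen T X Y) (r : Gen T X' Y') :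
    par q r = conj (β_ X X').hom (β_ Y' Y).hom (par r q) := by
  obtain ⟨U, m, rfl⟩ := q.exists_rep
  obtain ⟨V, n, rfl⟩ := r.exists_rep
  exact mk_tensor_swap m n

theorem par_conj_right (a : X'' ⟶ X) (b : Y ⟶ Y'') (q : Gen T X Y) (r : Gen T X' Y') :
    par r (conj a b q) = conj (X' ◁ a) (Y' ◁ b) (par r q) := by
  rw [par_comm, par_conj_left, par_comm r q, conj_conj, conj_conj]
  simp

theorem par_trace_left {V : C} (q : Gen T (X ⊗ V) (Y ⊗ V)) (r : Gen T X' Y') :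
    par (trace V q) r = trace V (conj
      ((α_ X X' V).hom ≫ X ◁ (β_ X' V).hom ≫ (α_ X V X').inv)
      ((α_ Y V Y').hom ≫ Y ◁ (β_ V Y').hom ≫ (α_ Y Y' V).inv) (par q r)) := by
  obtain ⟨U, m, rfl⟩ := q.exists_rep
  obtain ⟨W, n, rfl⟩ := r.exists_rep
  refine mk_iso (α_ _ _ _) ?_
  rw [tensorHom_split_left]
  simp only [Category.assoc]
  apply around_coherence (m ⊗ₘ n) <;> repeat' constructor

theorem par_trace_right {V : C} (q : Gen T (X ⊗ V) (Y ⊗ V)) (r : Gen T X' Y') :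
    par r (trace V q) = trace V (conj (α_ X' X V).hom (α_ Y' Y V).inv (par r q)) := by
  rw [par_comm, par_trace_left, par_comm r q, conj_trace, conj_conj, conj_conj]
  congr 2 <;> apply coherence <;> repeat' constructor

theorem par_assoc {X₁ X₂ X₃ Y₁ Y₂ Y₃ : C} (q : Gen T X₁ Y₁) (r : Gen T X₂ Y₂) (s : Gen T X₃ Y₃) :
    par (par q r) s = conj (α_ X₁ X₂ X₃).hom (α_ Y₁ Y₂ Y₃).inv (par q (par r s)) := by
  obtain ⟨U, m, rfl⟩ := q.exists_rep
  obtain ⟨V, n, rfl⟩ := r.exists_rep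
  obtain ⟨W, k, rfl⟩ := s.exists_rep
  refine mk_iso (α_ _ _ _) ?_
  rw [tensorHom_split_left, tensorHom_split_right]
  have h : ((m ⊗ₘ n) ⊗ₘ k) = (α_ _ _ _).hom ≫ (m ⊗ₘ (n ⊗ₘ k)) ≫ (α_ _ _ _).inv := by
    rw [← associator_naturality_assoc, Iso.hom_inv_id, Category.comp_id]
  rw [h]
  simp only [Category.assoc]
  apply around_coherence (m ⊗ₘ (n ⊗ₘ k)) <;> repeat' constructor

theorem par_ofHom (f : X ⟶ Y) (g : X' ⟶ Y') :
    par (ofHom T f) (ofHom T g) = ofHom T (f ⊗ₘ g) := by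
  refine mk_iso (λ_ _) ?_
  rw [whiskerRight_id, whiskerRight_id, whiskerRight_id, tensorHom_split_left,
    tensorHom_split_right]
  simp only [Category.assoc]
  apply around_coherence (f ⊗ₘ g) <;> repeat' constructor

/-- The total trace does not depend on the bracketing or the order of the strands in the loop. -/
theorem trace_conj_iso {U U' P Q : C} (u : U ≅ U') {a : X ⊗ U ⟶ P} {b : Q ⟶ Y ⊗ U}
    {a' : X ⊗ U' ⟶ P} {b' : Q ⟶ Y ⊗ U'} (q : Gen T P Q) (ha : a = X ◁ u.hom ≫ a')
    (hb : b ≫ Y ◁ u.hom = b') : trace U (conj a b q) = trace U' (conj a' b' q) := by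
  subst ha hb
  have := trace_slide (T := T) u.inv (conj (X ◁ u.hom ≫ a') (b ≫ Y ◁ u.hom) q)
  simpa only [conj_conj, Category.id_comp, Category.comp_id, Category.assoc,
    whiskerLeft_hom_inv, whiskerLeft_inv_hom_assoc] using this

theorem trace_ofHom_iso {U U' : C} (u : U ≅ U') {m : X ⊗ U ⟶ Y ⊗ U} {m' : X ⊗ U' ⟶ Y ⊗ U'}
    (h : m ≫ Y ◁ u.hom = X ◁ u.hom ≫ m') : trace U (ofHom T m) = trace U' (ofHom T m') := by
  rw [trace_ofHom_eq_mk, trace_ofHom_eq_mk]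
  exact mk_iso u h

theorem trace_unit (f : X ⊗ 𝟙_ C ⟶ Y ⊗ 𝟙_ C) :
    trace (𝟙_ C) (ofHom T f) = ofHom T ((ρ_ X).inv ≫ f ≫ (ρ_ Y).hom) :=
  trace_ofHom (by rw [T.vanishing_one]; exact Part.mem_some _)

variable (X Y X') in
/-- The exchange of the last two of three factors. -/
def _root_.IntPara.rot : (X ⊗ Y) ⊗ X' ⟶ (X ⊗ X') ⊗ Y :=
  (α_ X Y X').hom ≫ X ◁ (β_ Y X').hom ≫ (α_ X X' Y).inv

/-- A feedback loop that is merely a bend in a strand may be straightened. -/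
theorem trace_yank {V W : C} (x : X ⟶ W ⊗ V) (y : W ⊗ V ⟶ Y) :
    trace V (ofHom T (x ▷ V ≫ rot W V V ≫ y ▷ V)) = ofHom T (x ≫ y) := by
  have h : 𝟙 V ∈ T.tr V (β_ V V).hom := by rw [T.yanking]; exact Part.mem_some _
  have h' := T.naturality _ x y _ (T.superposing _ (𝟙 W) _ h)
  simp only [id_tensorHom, whiskerLeft_id, Category.id_comp] at h'
  exact trace_ofHom h'

end Gen
end PartialTrace
end IntPara

namespace IntPara

/-! ### Composition and tensor product of generalized arrows between pairs -/

variable {C : Type u} [Category.{v} C] [MonoidalCategory C] [SymmetricCategory C]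

/-- The exchange of the second and the fourth of four factors. -/
def swap₂₄ (X Y Z W : C) : (X ⊗ Y) ⊗ (Z ⊗ W) ⟶ (X ⊗ W) ⊗ (Z ⊗ Y) :=
  (X ⊗ Y) ◁ (β_ Z W).hom ≫ tensorμ X Y W Z ≫ (X ⊗ W) ◁ (β_ Y Z).hom

/-- The exchange of the first and the third of four factors. -/
def swap₁₃ (X Y Z W : C) : (X ⊗ Y) ⊗ (Z ⊗ W) ⟶ (Z ⊗ Y) ⊗ (X ⊗ W) :=
  (β_ X Y).hom ▷ (Z ⊗ W) ≫ tensorμ Y X Z W ≫ (β_ Y Z).hom ▷ (X ⊗ W)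

namespace PartialTrace.Gen

variable {T : PartialTrace C} {A B D E A' B' D' : IntP C}

/-- The composite of generalized arrows `f : A ⟶ B` and `g : B ⟶ D` of the Int construction:
both components of `B` are fed back. -/
def comp (f : Gen T (A.pos ⊗ B.neg) (B.pos ⊗ A.neg)) (g : Gen T (B.pos ⊗ D.neg) (D.pos ⊗ B.neg)) :
    Gen T (A.pos ⊗ D.neg) (D.pos ⊗ A.neg) :=
  trace (B.pos ⊗ B.neg)
    (conj (swap₂₄ A.pos D.neg B.pos B.neg) (swap₁₃ B.pos A.neg D.pos B.neg) (par f g))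

/-- Both sides are traces over the same four strands, up to their order in the loop. -/
theorem comp_assoc (f : Gen T (A.pos ⊗ B.neg) (B.pos ⊗ A.neg))
    (g : Gen T (B.pos ⊗ D.neg) (D.pos ⊗ B.neg)) (h : Gen T (D.pos ⊗ E.neg) (E.pos ⊗ D.neg)) :
    comp (comp f g) h = comp f (comp g h) := by
  simp only [comp, par_trace_left, par_trace_right, par_conj_left, par_conj_right, conj_trace,
    conj_conj, trace_trace, par_assoc]
  apply trace_conj_iso (β_ _ _) <;> apply coherence <;> repeat' constructor

/-- The tensor product of generalized arrows of the Int construction. -/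
def tens (f : Gen T (A.pos ⊗ A'.neg) (A'.pos ⊗ A.neg))
    (g : Gen T (B.pos ⊗ B'.neg) (B'.pos ⊗ B.neg)) :
    Gen T ((A.pos ⊗ B.pos) ⊗ (B'.neg ⊗ A'.neg)) ((A'.pos ⊗ B'.pos) ⊗ (B.neg ⊗ A.neg)) :=
  conj ((A.pos ⊗ B.pos) ◁ (β_ B'.neg A'.neg).hom ≫ tensorμ A.pos B.pos A'.neg B'.neg)
    (tensorμ A'.pos A.neg B'.pos B.neg ≫ (A'.pos ⊗ B'.pos) ◁ (β_ A.neg B.neg).hom) (par f g)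

theorem par_left_comm {X₁ X₂ X₃ Y₁ Y₂ Y₃ : C} (q : Gen T X₁ Y₁) (r : Gen T X₂ Y₂)
    (s : Gen T X₃ Y₃) :
    par q (par r s) = conj ((α_ X₁ X₂ X₃).inv ≫ (β_ X₁ X₂).hom ▷ X₃ ≫ (α_ X₂ X₁ X₃).hom)
      ((α_ Y₂ Y₁ Y₃).inv ≫ (β_ Y₂ Y₁).hom ▷ Y₃ ≫ (α_ Y₁ Y₂ Y₃).hom) (par r (par q s)) := by
  have h : par q (par r s) = conj (α_ X₁ X₂ X₃).inv (α_ Y₁ Y₂ Y₃).hom (par (par q r) s) := by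
    rw [par_assoc, conj_conj, Iso.inv_hom_id, Iso.inv_hom_id, conj_id]
  rw [h, par_comm q r, par_conj_left, par_assoc, conj_conj, conj_conj]
  simp only [Category.assoc]

theorem par_par_comm {X₁ X₂ X₃ X₄ Y₁ Y₂ Y₃ Y₄ : C} (q : Gen T X₁ Y₁) (r : Gen T X₂ Y₂)
    (s : Gen T X₃ Y₃) (t : Gen T X₄ Y₄) :
    par (par q r) (par s t) =
      conj (tensorμ X₁ X₂ X₃ X₄) (tensorμ Y₁ Y₃ Y₂ Y₄) (par (par q s) (par r t)) := by
  rw [par_assoc, par_assoc, par_left_comm r s t, par_conj_right, conj_conj, conj_conj]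
  congr 1 <;> apply coherence <;> repeat' constructor

/-- The interchange law. Both sides are traces over the same four strands. -/
theorem comp_tens {A₁ A₂ A₃ B₁ B₂ B₃ : IntP C}
    (f : Gen T (A₁.pos ⊗ A₂.neg) (A₂.pos ⊗ A₁.neg)) (f' : Gen T (A₂.pos ⊗ A₃.neg) (A₃.pos ⊗ A₂.neg))
    (g : Gen T (B₁.pos ⊗ B₂.neg) (B₂.pos ⊗ B₁.neg))
    (g' : Gen T (B₂.pos ⊗ B₃.neg) (B₃.pos ⊗ B₂.neg)) :
    comp (A := A₁.tensor B₁) (B := A₂.tensor B₂) (D := A₃.tensor B₃) (tens f g) (tens f' g') =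
      tens (comp f f') (comp g g') := by
  simp only [comp, tens, IntP.tensor, par_trace_left, par_trace_right, par_conj_left,
    par_conj_right, conj_trace, conj_conj, trace_trace, par_par_comm f g]
  let u : (A₂.pos ⊗ B₂.pos) ⊗ (B₂.neg ⊗ A₂.neg) ≅ (B₂.pos ⊗ B₂.neg) ⊗ (A₂.pos ⊗ A₂.neg) :=
    { hom := (β_ _ _).hom ▷ _ ≫ tensorμ _ _ _ _
      inv := tensorμ _ _ _ _ ≫ (β_ _ _).hom ▷ _
      hom_inv_id := by apply coherence <;> repeat' constructor
      inv_hom_id := by apply coherence <;> repeat' constructor }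
  apply trace_conj_iso u <;> apply coherence <;> repeat' constructor

section Rot

variable {X Y Z X' Y' Z' : C}

theorem rot_rot : rot X Y Z ≫ rot X Z Y = 𝟙 _ := by
  apply coherence <;> repeat' constructor

theorem rot_left (f : X ⟶ X') : f ▷ Y ▷ Z ≫ rot X' Y Z = rot X Y Z ≫ f ▷ Z ▷ Y := by
  simp only [rot, Category.assoc]
  rw [associator_naturality_left_assoc, ← whisker_exchange_assoc, associator_inv_naturality_left]

theorem rot_mid (f : Y ⟶ Y') : (X ◁ f) ▷ Z ≫ rot X Y' Z = rot X Y Z ≫ (X ⊗ Z) ◁ f := by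
  simp only [rot, Category.assoc]
  rw [associator_naturality_middle_assoc, ← whiskerLeft_comp_assoc,
    BraidedCategory.braiding_naturality_left, whiskerLeft_comp_assoc,
    associator_inv_naturality_right]

theorem rot_right (f : Z ⟶ Z') : (X ⊗ Y) ◁ f ≫ rot X Y Z' = rot X Y Z ≫ (X ◁ f) ▷ Y := by
  simp only [rot, Category.assoc]
  rw [associator_naturality_right_assoc, ← whiskerLeft_comp_assoc,
    BraidedCategory.braiding_naturality_right, whiskerLeft_comp_assoc,
    associator_inv_naturality_middle]

theorem rot_rot_assoc (k : (X ⊗ Y) ⊗ Z ⟶ Z') : rot X Y Z ≫ rot X Z Y ≫ k = k := by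
  rw [← Category.assoc, rot_rot, Category.id_comp]

theorem rot_left_assoc (f : X ⟶ X') (k : (X' ⊗ Z) ⊗ Y ⟶ Z') :
    f ▷ Y ▷ Z ≫ rot X' Y Z ≫ k = rot X Y Z ≫ f ▷ Z ▷ Y ≫ k := by
  rw [← Category.assoc, rot_left, Category.assoc]

theorem rot_mid_assoc (f : Y ⟶ Y') (k : (X ⊗ Z) ⊗ Y' ⟶ Z') :
    (X ◁ f) ▷ Z ≫ rot X Y' Z ≫ k = rot X Y Z ≫ (X ⊗ Z) ◁ f ≫ k := by
  rw [← Category.assoc, rot_mid, Category.assoc]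

end Rot

theorem whisker_comm {P Q X Y : C} (f : P ⟶ Q) :
    f ▷ X ▷ Y = (α_ P X Y).hom ≫ P ◁ (β_ X Y).hom ≫ f ▷ (Y ⊗ X) ≫ Q ◁ (β_ Y X).hom ≫
      (α_ Q X Y).inv := by
  rw [whisker_exchange_assoc, ← whiskerLeft_comp_assoc]
  simp

/-- The symmetry as an isomorphism whose inverse is again written as a symmetry. -/
@[simps]
def swapIso (X Y : C) : X ⊗ Y ≅ Y ⊗ X where
  hom := (β_ X Y).hom
  inv := (β_ Y X).hom

/-- Moves an arrow to the right of all idle strands, after combining these into one object. This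
is a normal form for one arrow among idle strands. -/
theorem whisker_iso {P Q X Y Z : C} (f : P ⟶ Q) (e : X ⊗ Y ≅ Z) :
    f ▷ X ▷ Y = ((α_ P X Y).hom ≫ P ◁ e.hom ≫ (β_ P Z).hom) ≫ Z ◁ f ≫
      (β_ Z Q).hom ≫ Q ◁ e.inv ≫ (α_ Q X Y).inv := by
  simp only [Category.assoc]
  rw [← BraidedCategory.braiding_naturality_left_assoc, SymmetricCategory.symmetry_assoc,
    whisker_exchange_assoc, whiskerLeft_hom_inv_assoc]
  simp

variable (A B D) in
/-- The strands before the first arrow of `seq`. -/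
def seqIn (R : C) : (A.pos ⊗ D.neg) ⊗ (B.neg ⊗ R) ⟶ ((A.pos ⊗ B.neg) ⊗ R) ⊗ D.neg :=
  (α_ _ _ _).inv ≫ rot A.pos D.neg B.neg ▷ R ≫ rot (A.pos ⊗ B.neg) D.neg R

variable (A B D) in
/-- The strands between the two arrows of `seq`. -/
def seqMid (R : C) : ((B.pos ⊗ A.neg) ⊗ R) ⊗ D.neg ⟶ (B.pos ⊗ D.neg) ⊗ (R ⊗ A.neg) :=
  rot (B.pos ⊗ A.neg) R D.neg ≫ rot B.pos A.neg D.neg ▷ R ≫ (α_ _ _ _).hom ≫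
    (B.pos ⊗ D.neg) ◁ (β_ A.neg R).hom

variable (A B D) in
/-- The strands after the second arrow of `seq`. -/
def seqOut (R : C) : (D.pos ⊗ B.neg) ⊗ (R ⊗ A.neg) ⟶ (D.pos ⊗ A.neg) ⊗ (B.neg ⊗ R) :=
  (α_ _ _ _).inv ≫ (α_ D.pos B.neg R).hom ▷ A.neg ≫ rot D.pos (B.neg ⊗ R) A.neg

/-- The arrow of `C` whose trace is a composite in which `c` is itself to be traced over `R`:
first `c` and then `g` is applied, and the negative strand between them is fed back. -/
def seq {R : C} (c : (A.pos ⊗ B.neg) ⊗ R ⟶ (B.pos ⊗ A.neg) ⊗ R)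
    (g : B.pos ⊗ D.neg ⟶ D.pos ⊗ B.neg) :
    (A.pos ⊗ D.neg) ⊗ (B.neg ⊗ R) ⟶ (D.pos ⊗ A.neg) ⊗ (B.neg ⊗ R) :=
  seqIn A B D R ≫ c ▷ D.neg ≫ seqMid A B D R ≫ g ▷ (R ⊗ A.neg) ≫ seqOut A B D R

/-- Yanking removes the strand `B.pos` from the loop of the composite, as the trace over it only
connects the output of `c` to the input of `g`. -/
theorem comp_trace_ofHom {R : C} (c : (A.pos ⊗ B.neg) ⊗ R ⟶ (B.pos ⊗ A.neg) ⊗ R)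
    (g : B.pos ⊗ D.neg ⟶ D.pos ⊗ B.neg) :
    comp (trace R (ofHom T c)) (ofHom T g) = trace (B.neg ⊗ R) (ofHom T (seq c g)) := by
  have h := trace_yank (T := T)
    (seqIn A B D R ≫ c ▷ D.neg ≫ seqMid A B D R ≫ (α_ _ _ _).hom ≫ (β_ B.pos _).hom)
    ((β_ _ B.pos).hom ≫ (α_ _ _ _).inv ≫ g ▷ (R ⊗ A.neg) ≫ seqOut A B D R)
  simp only [Category.assoc, SymmetricCategory.symmetry_assoc, Iso.hom_inv_id_assoc] at h
  rw [seq, ← h]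
  simp only [comp, par_trace_left, conj_trace, trace_trace, par_ofHom, conj_ofHom]
  apply trace_ofHom_iso (α_ _ _ _ ≪≫ β_ _ _)
  simp only [comp_whiskerRight, Category.assoc, whisker_comm c, whisker_iso g
    (swapIso _ _ ≪≫ whiskerLeftIso _ (swapIso _ _) ≪≫ (α_ B.pos A.neg R).symm),
    MonoidalCategory.tensorHom_def]
  apply around_coherence₂ (c ▷ (B.pos ⊗ D.neg))
    (((B.pos ⊗ A.neg) ⊗ R) ◁ g) <;> repeat' constructor

/-- The composite of two arrows of the Int construction needs a feedback of the negative strand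
only. -/
theorem comp_ofHom (f : A.pos ⊗ B.neg ⟶ B.pos ⊗ A.neg) (g : B.pos ⊗ D.neg ⟶ D.pos ⊗ B.neg) :
    comp (ofHom T f) (ofHom T g) = trace B.neg (ofHom T
      (rot A.pos D.neg B.neg ≫ f ▷ D.neg ≫ rot B.pos A.neg D.neg ≫ g ▷ A.neg ≫
        rot D.pos B.neg A.neg)) := by
  have h : ofHom T f = trace (𝟙_ C) (ofHom T (f ▷ 𝟙_ C)) := by rw [trace_unit]; simp
  rw [h, comp_trace_ofHom]
  apply trace_ofHom_iso (ρ_ _)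
  simp only [seq, Category.assoc, whiskerRight_id, whiskerRight_tensor, comp_whiskerRight]
  apply around_coherence₂ (f ▷ D.neg)
    (g ▷ A.neg) <;> repeat' constructor

/-- Composing with a pair of arrows in the two components involves no feedback. -/
theorem comp_ofHom_tensor (f : A.pos ⊗ B.neg ⟶ B.pos ⊗ A.neg) (a : B.pos ⟶ D.pos)
    (b : D.neg ⟶ B.neg) :
    comp (ofHom T f) (ofHom T (a ⊗ₘ b)) = ofHom T (A.pos ◁ b ≫ f ≫ a ▷ A.neg) := by
  rw [comp_ofHom]
  refine Eq.trans ?_ (trace_yank (A.pos ◁ b) (f ≫ a ▷ A.neg))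
  congr 2
  simp only [MonoidalCategory.tensorHom_def', comp_whiskerRight, Category.assoc, rot_left,
    rot_mid_assoc]
  rw [rot_rot_assoc, whisker_exchange_assoc]

/-- Composing with a pair of arrows in the two components involves no feedback. -/
theorem comp_tensor_ofHom (a : A.pos ⟶ B.pos) (b : B.neg ⟶ A.neg)
    (g : B.pos ⊗ D.neg ⟶ D.pos ⊗ B.neg) :
    comp (ofHom T (a ⊗ₘ b)) (ofHom T g) = ofHom T (a ▷ D.neg ≫ g ≫ D.pos ◁ b) := by
  have h := trace_yank (T := T) (a ▷ D.neg ≫ g) (D.pos ◁ b)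
  rw [Category.assoc] at h
  rw [comp_ofHom, ← h]
  congr 2
  simp only [MonoidalCategory.tensorHom_def, comp_whiskerRight, Category.assoc, rot_left_assoc,
    rot_mid_assoc]
  rw [rot_rot_assoc, whisker_exchange_assoc, rot_right]

end PartialTrace.Gen
end IntPara

namespace IntPara

/-! ### Total composites of paths -/

variable {C : Type u} [Category.{v} C] [MonoidalCategory C] [SymmetricCategory C]

open PartialTrace Gen

variable {A B D : IntP C} (T : PartialTrace C)

/-- The total composite of a path of the Int construction, as a generalized arrow. -/
def pathGen : ∀ {B : IntP C}, Quiver.Path A B → Gen T (A.pos ⊗ B.neg) (B.pos ⊗ A.neg)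
  | _, .nil => ofHom T (𝟙 _)
  | _, .cons p f => comp (pathGen p) (ofHom T f.mor)

variable {T}

theorem id_comp_ofHom (f : A.pos ⊗ B.neg ⟶ B.pos ⊗ A.neg) :
    comp (ofHom T (𝟙 (A.pos ⊗ A.neg))) (ofHom T f) = ofHom T f := by
  rw [← id_tensorHom_id, comp_tensor_ofHom]
  simp

theorem ofHom_comp_id (f : A.pos ⊗ B.neg ⟶ B.pos ⊗ A.neg) :
    comp (ofHom T f) (ofHom T (𝟙 (B.pos ⊗ B.neg))) = ofHom T f := by
  rw [← id_tensorHom_id, comp_ofHom_tensor]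
  simp

theorem pathGen_toPath (f : A ⟶ B) : pathGen T f.toPath = ofHom T f.mor := id_comp_ofHom _

/-- For an empty `q` this needs that a total composite is unchanged by composition with an
identity, which is verified only for arrows of `C`, and for others by `comp_assoc`. -/
theorem pathGen_comp (p : Quiver.Path A B) (q : Quiver.Path B D) :
    pathGen T (p.comp q) = comp (pathGen T p) (pathGen T q) := by
  induction q with
  | nil =>
    cases p with
    | nil => exact (id_comp_ofHom _).symm
    | cons p f =>
      refine Eq.trans ?_ (comp_assoc _ _ _).symm
      exact congrArg (comp (pathGen T p)) (ofHom_comp_id _).symm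
  | cons q f ih => rw [Quiver.Path.comp_cons, pathGen, pathGen, ih, comp_assoc]

theorem pyramidTwisted_nil (f : A ⟶ B) :
    pyramidTwisted .nil f = (ρ_ _).hom ≫ f.mor ≫ (ρ_ _).inv := by
  have h : f.mor ▷ 𝟙_ C = (ρ_ _).hom ≫ f.mor ≫ (ρ_ _).inv := whiskerRight_id _
  simp only [pyramidTwisted, pyramid, core, src, rev, fwd, regroup, γ, h, Category.assoc]
  apply around_coherence f.mor <;> repeat' constructor

/-- The step from the pyramid of a path to the pyramid of a path with one more arrow `f`, for
arbitrary arrows `k`, `r` and `c` in the places of `γ`, `regroup` and `core`. -/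
theorem seq_pyramid {E : IntP C} {R F S : C} (k : R ⟶ F) (c : A.pos ⊗ (F ⊗ D.neg) ⟶ D.pos ⊗ S)
    (r : S ⟶ R ⊗ A.neg) (f : D.pos ⊗ E.neg ⟶ E.pos ⊗ D.neg) :
    ((A.pos ⊗ E.neg) ◁ ((β_ D.neg R).hom ≫ k ▷ D.neg)) ≫ (α_ A.pos E.neg (F ⊗ D.neg)).hom ≫
      (A.pos ◁ (β_ E.neg (F ⊗ D.neg)).hom) ≫
      ((α_ A.pos (F ⊗ D.neg) E.neg).inv ≫ (c ▷ E.neg) ≫ (α_ D.pos S E.neg).hom ≫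
        (D.pos ◁ (β_ S E.neg).hom) ≫ (α_ D.pos E.neg S).inv ≫
        (f ▷ S) ≫ (α_ E.pos D.neg S).hom) ≫
      (E.pos ◁ ((D.neg ◁ r) ≫ (α_ D.neg R A.neg).inv)) ≫
      (E.pos ◁ (β_ (D.neg ⊗ R) A.neg).hom) ≫ (α_ E.pos A.neg (D.neg ⊗ R)).inv =
    seq (((A.pos ⊗ D.neg) ◁ k) ≫ (α_ A.pos D.neg F).hom ≫ (A.pos ◁ (β_ D.neg F).hom) ≫
      c ≫ (D.pos ◁ r) ≫ (D.pos ◁ (β_ R A.neg).hom) ≫ (α_ D.pos A.neg R).inv) f := by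
  have h₁ := rot_right (X := A.pos) (Y := E.neg) (k ▷ D.neg)
  have h₂ := rot_mid (X := D.pos) (Z := E.neg) r
  have h₃ : (A.pos ⊗ D.neg) ◁ k ≫ (α_ A.pos D.neg F).hom ≫ A.pos ◁ (β_ D.neg F).hom =
      (α_ A.pos D.neg R).hom ≫ A.pos ◁ (β_ D.neg R).hom ≫ A.pos ◁ (k ▷ D.neg) := by
    rw [associator_naturality_right_assoc, ← whiskerLeft_comp, ← whiskerLeft_comp,
      BraidedCategory.braiding_naturality_right]
  -- The part of the diagram before `f` has to be a single arrow for `around_coherence₂`.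
  have h₄ {Z : C} (x : (D.pos ⊗ R ⊗ A.neg) ⊗ E.neg ⟶ Z) :
      (A.pos ◁ (k ▷ D.neg)) ▷ E.neg ≫ c ▷ E.neg ≫ (D.pos ◁ r) ▷ E.neg ≫ x =
        (A.pos ◁ (k ▷ D.neg) ≫ c ≫ D.pos ◁ r) ▷ E.neg ≫ x := by
    simp only [comp_whiskerRight, Category.assoc]
  rw [seq, reassoc_of% h₃]
  simp only [rot, whiskerLeft_comp, comp_whiskerRight, Category.assoc] at h₁ h₂ ⊢
  rw [← associator_naturality_right_assoc, ← whisker_exchange_assoc, ← reassoc_of% h₂,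
    reassoc_of% h₁, h₄, h₄]
  apply around_coherence₂ ((A.pos ◁ (k ▷ D.neg) ≫ c ≫ D.pos ◁ r) ▷ E.neg)
    (f ▷ (R ⊗ A.neg)) <;> repeat' constructor

theorem pyramidTwisted_cons {E : IntP C} (p : Quiver.Path A B) (g : B ⟶ D) (f : D ⟶ E) :
    pyramidTwisted (p.cons g) f = seq (pyramidTwisted p g) f.mor :=
  seq_pyramid (γ p) (core (p.cons g)) (regroup p) f.mor

/-- The total composite of a nonempty path is the trace of its pyramid. -/
theorem pathGen_cons (p : Quiver.Path A B) (f : B ⟶ D) :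
    pathGen T (p.cons f) = trace (rev p) (ofHom T (pyramidTwisted p f)) := by
  induction p generalizing D with
  | nil =>
    rw [pyramidTwisted_nil]
    refine (pathGen_toPath f).trans ((trace_unit _).trans ?_).symm
    simp
  | cons p g ih => rw [pathGen, ih, comp_trace_ofHom, pyramidTwisted_cons]; rfl

variable (T) in
/-- The description of a composite as the trace of a pyramid also holds for paths of length one,
where the trace is taken over the unit object. -/
theorem intComp_cons (p : Quiver.Path A B) (f : B ⟶ D) :
    intComp T (p.cons f) = (T.tr (rev p) (pyramidTwisted p f)).map IntP.Hom.mk := by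
  cases p with
  | nil =>
    rw [pyramidTwisted_nil]
    refine Eq.symm ((congrArg _ (T.vanishing_one _)).trans ?_)
    simp [intComp]
    rfl
  | cons p g => rfl

/-- The partial composite of a path is its total composite, as far as the latter is an arrow
of `C`. -/
theorem mem_intComp_iff (p : Quiver.Path A B) (g : A ⟶ B) :
    g ∈ intComp T p ↔ pathGen T p = ofHom T g.mor := by
  cases p with
  | nil =>
    refine Part.mem_some_iff.trans ⟨fun h => h ▸ rfl, fun h => ?_⟩
    exact IntP.Hom.ext (ofHom_injective h).symm
  | cons p f =>
    rw [intComp_cons, pathGen_cons, ← mem_tr_iff, Part.mem_map_iff]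
    exact ⟨fun ⟨t, ht, h⟩ => h ▸ ht, fun h => ⟨_, h, rfl⟩⟩

theorem intComp_eq_of_pathGen_eq {p q : Quiver.Path A B} (h : pathGen T p = pathGen T q) :
    intComp T p = intComp T q :=
  Part.ext fun g => by rw [mem_intComp_iff, mem_intComp_iff, h]

/-- Associativity of the partial composition is associativity of the total composition, since
replacing a path by its composite, where defined, does not change the total composite. -/
theorem isParacategory_intComp (T : PartialTrace C) : IsParacategory (intComp T) where
  nil_dom _ := trivial
  single _ := rfl
  assoc r f s g hg := by
    apply intComp_eq_of_pathGen_eq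
    rw [pathGen_comp, pathGen_comp, pathGen_comp, pathGen_comp, pathGen_toPath,
      (mem_intComp_iff f g).1 hg]

theorem intComp_path₂_eq_some {f : A ⟶ B} {g : B ⟶ D} {k : A ⟶ D}
    (h : comp (ofHom T f.mor) (ofHom T g.mor) = ofHom T k.mor) :
    intComp T (path₂ f g) = Part.some k := by
  rw [Part.eq_some_iff, mem_intComp_iff, ← h]
  exact congrArg (fun x => comp x (ofHom T g.mor)) (id_comp_ofHom _)

theorem pathGen_path₂ (f : A ⟶ B) (g : B ⟶ D) :
    pathGen T (path₂ f g) = comp (ofHom T f.mor) (ofHom T g.mor) :=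
  congrArg (fun x => comp x (ofHom T g.mor)) (id_comp_ofHom _)

/-! ### The tensor product of arrows -/

section Tensor

variable {A' B' : IntP C}

/-- Moves an arrow to the left of the idle strands on its two sides. -/
theorem whisker_both_left {P Q X Y : C} (f : P ⟶ Q) :
    X ◁ (f ▷ Y) = (α_ X P Y).inv ≫ (β_ X P).hom ▷ Y ≫ (α_ P X Y).hom ≫ f ▷ (X ⊗ Y) ≫
      (α_ Q X Y).inv ≫ (β_ Q X).hom ▷ Y ≫ (α_ X Q Y).hom := by
  rw [← associator_naturality_left_assoc, Iso.hom_inv_id_assoc, ← comp_whiskerRight_assoc,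
    ← comp_whiskerRight_assoc, Category.assoc, BraidedCategory.braiding_naturality_left,
    SymmetricCategory.symmetry_assoc]
  simp

/-- Moves an arrow to the right of the idle strands on its two sides. -/
theorem whisker_both_right {P Q X Y : C} (f : P ⟶ Q) :
    X ◁ (f ▷ Y) = X ◁ (β_ P Y).hom ≫ (α_ X Y P).inv ≫ (X ⊗ Y) ◁ f ≫ (α_ X Y Q).hom ≫
      X ◁ (β_ Y Q).hom := by
  rw [associator_naturality_right_assoc, Iso.inv_hom_id_assoc, ← whiskerLeft_comp,
    ← whiskerLeft_comp, BraidedCategory.braiding_naturality_right,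
    SymmetricCategory.symmetry_assoc]

/-- The tensor product of arrows of the Int construction, as an operation on arrows of `C`: the
tensor product in `C` between two permutations of the factors. -/
def tensorMor {X₁ X₂ X₃ X₄ Y₁ Y₂ Y₃ Y₄ : C} (f : X₁ ⊗ X₂ ⟶ X₃ ⊗ X₄) (g : Y₁ ⊗ Y₂ ⟶ Y₃ ⊗ Y₄) :
    (X₁ ⊗ Y₁) ⊗ (Y₂ ⊗ X₂) ⟶ (X₃ ⊗ Y₃) ⊗ (Y₄ ⊗ X₄) :=
  ((X₁ ⊗ Y₁) ◁ (β_ Y₂ X₂).hom ≫ tensorμ X₁ Y₁ X₂ Y₂) ≫ (f ⊗ₘ g) ≫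
    (tensorμ X₃ X₄ Y₃ Y₄ ≫ (X₃ ⊗ Y₃) ◁ (β_ X₄ Y₄).hom)

theorem tensorMor_eq {X₁ X₂ X₃ X₄ Y₁ Y₂ Y₃ Y₄ : C} (f : X₁ ⊗ X₂ ⟶ X₃ ⊗ X₄)
    (g : Y₁ ⊗ Y₂ ⟶ Y₃ ⊗ Y₄) :
    ((β_ X₁ Y₁).hom ⊗ₘ (β_ Y₂ X₂).hom) ≫
      (midAssoc Y₁ X₁ X₂ Y₂).hom ≫ (Y₁ ◁ (f ▷ Y₂)) ≫ (midAssoc Y₁ X₃ X₄ Y₂).inv ≫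
      ((β_ Y₁ X₃).hom ⊗ₘ (β_ X₄ Y₂).hom) ≫
      (midAssoc X₃ Y₁ Y₂ X₄).hom ≫ (X₃ ◁ (g ▷ X₄)) ≫ (midAssoc X₃ Y₃ Y₄ X₄).inv =
      tensorMor f g := by
  simp only [tensorMor, whisker_both_left f, whisker_both_right g,
    MonoidalCategory.tensorHom_def f, Category.assoc]
  apply around_coherence₂ (f ▷ (Y₁ ⊗ Y₂)) ((X₃ ⊗ X₄) ◁ g) <;> repeat' constructor

theorem tensorHom_mor (f : A ⟶ A') (g : B ⟶ B') :
    (IntP.tensorHom f g).mor = tensorMor f.mor g.mor :=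
  tensorMor_eq f.mor g.mor

theorem ofHom_tensorHom (f : A ⟶ A') (g : B ⟶ B') :
    ofHom T (IntP.tensorHom f g).mor = tens (ofHom T f.mor) (ofHom T g.mor) := by
  rw [tensorHom_mor, tens, par_ofHom, conj_ofHom]
  rfl

end Tensor

end IntPara

namespace IntPara

/-! ### Transport in a strict monoidal category -/

variable {C : Type u} [Category.{v} C] [MonoidalCategory C]

theorem associator_inv_eq [StrictMonoidal C] (X Y Z : C) :
    (α_ X Y Z).inv = eqToHom (StrictMonoidal.assoc_obj X Y Z).symm := by
  rw [← cancel_epi (α_ X Y Z).hom, Iso.hom_inv_id, StrictMonoidal.associator_hom]; simp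

theorem leftUnitor_inv_eq [StrictMonoidal C] (X : C) :
    (λ_ X).inv = eqToHom (StrictMonoidal.unit_obj X).symm := by
  rw [← cancel_epi (λ_ X).hom, Iso.hom_inv_id, StrictMonoidal.leftUnitor_hom]; simp

theorem rightUnitor_inv_eq [StrictMonoidal C] (X : C) :
    (ρ_ X).inv = eqToHom (StrictMonoidal.obj_unit X).symm := by
  rw [← cancel_epi (ρ_ X).hom, Iso.hom_inv_id, StrictMonoidal.rightUnitor_hom]; simp

/-- Transport along equalities of objects is composition with identity maps. In a strict monoidal
category these are associators and unitors, which turns equations with transports into equations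
between structural maps. -/
theorem cast_mor {A B A' B' : IntP C} (hA : A = A') (hB : B = B') (f : A ⟶ B) {a : A'.pos ⟶ A.pos}
    {b : B'.neg ⟶ B.neg} {a' : B.pos ⟶ B'.pos} {b' : A.neg ⟶ A'.neg}
    (ha : a = eqToHom (hA ▸ rfl)) (hb : b = eqToHom (hB ▸ rfl)) (ha' : a' = eqToHom (hB ▸ rfl))
    (hb' : b' = eqToHom (hA ▸ rfl)) :
    (f.cast hA hB).mor = (a ⊗ₘ b) ≫ f.mor ≫ (a' ⊗ₘ b') := by
  subst hA hB ha hb ha' hb'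
  simp

variable [SymmetricCategory C]

open PartialTrace Gen

/-! ### The symmetric monoidal structure -/

section TensorMor

variable {X₁ X₂ X₃ X₄ Y₁ Y₂ Y₃ Y₄ Z₁ Z₂ Z₃ Z₄ : C}

theorem tensorMor_assoc (f : X₁ ⊗ X₂ ⟶ X₃ ⊗ X₄) (g : Y₁ ⊗ Y₂ ⟶ Y₃ ⊗ Y₄)
    (h : Z₁ ⊗ Z₂ ⟶ Z₃ ⊗ Z₄) :
    ((α_ X₁ Y₁ Z₁).inv ⊗ₘ (α_ Z₂ Y₂ X₂).hom) ≫ tensorMor (tensorMor f g) h ≫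
      ((α_ X₃ Y₃ Z₃).hom ⊗ₘ (α_ Z₄ Y₄ X₄).inv) = tensorMor f (tensorMor g h) := by
  have h' : ((f ⊗ₘ g) ⊗ₘ h) = (α_ _ _ _).hom ≫ (f ⊗ₘ (g ⊗ₘ h)) ≫ (α_ _ _ _).inv := by
    rw [← associator_naturality_assoc, Iso.hom_inv_id, Category.comp_id]
  simp only [tensorMor]
  rw [tensorHom_split_left, tensorHom_split_right, h']
  simp only [Category.assoc]
  apply around_coherence (f ⊗ₘ (g ⊗ₘ h)) <;> repeat' constructor

theorem tensorMor_unit_left (f : X₁ ⊗ X₂ ⟶ X₃ ⊗ X₄) :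
    ((λ_ X₁).inv ⊗ₘ (ρ_ X₂).inv) ≫ tensorMor (𝟙 (𝟙_ C ⊗ 𝟙_ C)) f ≫
      ((λ_ X₃).hom ⊗ₘ (ρ_ X₄).hom) = f := by
  rw [tensorMor, id_tensorHom, tensor_whiskerLeft _ _ f, id_whiskerLeft (_ ◁ f), id_whiskerLeft f]
  simp only [Category.assoc]
  refine Eq.trans ?_ ((Category.id_comp _).trans (Category.comp_id f))
  apply around_coherence f <;> repeat' constructor

theorem tensorMor_unit_right (f : X₁ ⊗ X₂ ⟶ X₃ ⊗ X₄) :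
    ((ρ_ X₁).inv ⊗ₘ (λ_ X₂).inv) ≫ tensorMor f (𝟙 (𝟙_ C ⊗ 𝟙_ C)) ≫
      ((ρ_ X₃).hom ⊗ₘ (λ_ X₄).hom) = f := by
  rw [tensorMor, tensorHom_id, whiskerRight_tensor f, whiskerRight_id (f ▷ _), whiskerRight_id f]
  simp only [Category.assoc]
  refine Eq.trans ?_ ((Category.id_comp _).trans (Category.comp_id f))
  apply around_coherence f <;> repeat' constructor

theorem tensorMor_id : tensorMor (𝟙 (X₁ ⊗ X₂)) (𝟙 (Y₁ ⊗ Y₂)) = 𝟙 _ := by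
  apply coherence <;> repeat' constructor

theorem tensorMor_braiding_left (f : X₁ ⊗ X₂ ⟶ X₃ ⊗ X₄) :
    (X₁ ⊗ Y₁) ◁ (β_ X₂ Y₂).hom ≫ tensorMor f (𝟙 (Y₁ ⊗ Y₂)) ≫ (β_ X₃ Y₁).hom ▷ (Y₂ ⊗ X₄) =
      (β_ X₁ Y₁).hom ▷ (X₂ ⊗ Y₂) ≫ tensorMor (𝟙 (Y₁ ⊗ Y₂)) f ≫
        (Y₁ ⊗ X₃) ◁ (β_ X₄ Y₂).hom := by
  rw [tensorMor, tensorMor, tensorHom_swap (𝟙 _) f]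
  simp only [Category.assoc]
  apply around_coherence (f ⊗ₘ 𝟙 (Y₁ ⊗ Y₂)) <;> repeat' constructor

theorem tensorMor_braiding_right (g : Y₁ ⊗ Y₂ ⟶ Y₃ ⊗ Y₄) :
    (X₁ ⊗ Y₁) ◁ (β_ X₂ Y₂).hom ≫ tensorMor (𝟙 (X₁ ⊗ X₂)) g ≫ (β_ X₁ Y₃).hom ▷ (Y₄ ⊗ X₂) =
      (β_ X₁ Y₁).hom ▷ (X₂ ⊗ Y₂) ≫ tensorMor g (𝟙 (X₁ ⊗ X₂)) ≫
        (Y₃ ⊗ X₁) ◁ (β_ X₂ Y₄).hom := by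
  rw [tensorMor, tensorMor, tensorHom_swap (𝟙 _) g]
  simp only [Category.assoc]
  apply around_coherence (g ⊗ₘ 𝟙 (X₁ ⊗ X₂)) <;> repeat' constructor

end TensorMor

variable {T : PartialTrace C} {A B D A' B' : IntP C}

theorem pathGen_mapPath_left (X : IntP C) (p : Quiver.Path A B) :
    pathGen T (((intTensor C).left (IntP.id X)).mapPath p) =
      tens (ofHom T (IntP.id X).mor) (pathGen T p) := by
  induction p with
  | nil =>
    refine Eq.trans ?_ (ofHom_tensorHom (T := T) (IntP.id X) (IntP.id A))
    exact congrArg (ofHom T) tensorMor_id.symm |>.trans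
      (congrArg (ofHom T) (tensorHom_mor (IntP.id X) (IntP.id A)).symm)
  | cons p f ih =>
    refine (congrArg₂ comp ih (ofHom_tensorHom (IntP.id X) f)).trans ((comp_tens _ _ _ _).trans ?_)
    exact congrArg₂ tens (id_comp_ofHom _) rfl

theorem pathGen_mapPath_right (X : IntP C) (p : Quiver.Path A B) :
    pathGen T (((intTensor C).right (IntP.id X)).mapPath p) =
      tens (pathGen T p) (ofHom T (IntP.id X).mor) := by
  induction p with
  | nil =>
    refine Eq.trans ?_ (ofHom_tensorHom (T := T) (IntP.id A) (IntP.id X))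
    exact congrArg (ofHom T) tensorMor_id.symm |>.trans
      (congrArg (ofHom T) (tensorHom_mor (IntP.id A) (IntP.id X)).symm)
  | cons p f ih =>
    refine (congrArg₂ comp ih (ofHom_tensorHom f (IntP.id X))).trans ((comp_tens _ _ _ _).trans ?_)
    exact congrArg₂ tens rfl (id_comp_ofHom _)

theorem mem_intComp_path₂_iff {f : A ⟶ B} {g : B ⟶ D} {k : A ⟶ D} :
    k ∈ intComp T (path₂ f g) ↔ comp (ofHom T f.mor) (ofHom T g.mor) = ofHom T k.mor := by
  rw [mem_intComp_iff, pathGen_path₂]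

theorem pathGen_symm_comp {X : IntP C} (f : (intTensor C).obj B A ⟶ X) :
    pathGen T (path₂ ((intTensor C).symm A B) f) =
      ofHom T ((β_ A.pos B.pos).hom ▷ X.neg ≫ f.mor ≫ X.pos ◁ (β_ A.neg B.neg).hom) :=
  (pathGen_path₂ _ _).trans (comp_tensor_ofHom _ _ _)

theorem pathGen_comp_symm {X : IntP C} (f : X ⟶ (intTensor C).obj A B) :
    pathGen T (path₂ f ((intTensor C).symm A B)) =
      ofHom T (X.pos ◁ (β_ A.neg B.neg).hom ≫ f.mor ≫ (β_ A.pos B.pos).hom ▷ X.neg) :=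
  (pathGen_path₂ _ _).trans (comp_ofHom_tensor _ _ _)

section Strict

variable [StrictMonoidal C]

theorem tensor_assoc (A B D : IntP C) :
    (intTensor C).obj ((intTensor C).obj A B) D = (intTensor C).obj A ((intTensor C).obj B D) :=
  IntP.ext (StrictMonoidal.assoc_obj _ _ _) (StrictMonoidal.assoc_obj _ _ _).symm

theorem unit_tensor (A : IntP C) : (intTensor C).obj (intTensor C).unit A = A :=
  IntP.ext (StrictMonoidal.unit_obj _) (StrictMonoidal.obj_unit _)

theorem tensor_unit (A : IntP C) : (intTensor C).obj A (intTensor C).unit = A :=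
  IntP.ext (StrictMonoidal.obj_unit _) (StrictMonoidal.unit_obj _)

/-- The Int construction is a strict symmetric monoidal paracategory. -/
theorem isSSMPC_intComp (T : PartialTrace C) : IsSSMPC (intComp T) (intTensor C) where
  toIsParacategory := isParacategory_intComp T
  assoc_obj := tensor_assoc
  unit_obj := unit_tensor
  obj_unit := tensor_unit
  assoc_hom {A A' B B' D D'} f g h := by
    apply IntP.Hom.ext
    rw [cast_mor _ _ _ (associator_inv_eq _ _ _) (StrictMonoidal.associator_hom _ _ _)
      (StrictMonoidal.associator_hom _ _ _) (associator_inv_eq _ _ _)]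
    have h₁ : ∀ {P P' Q Q' : IntP C} (f : P ⟶ P') (g : Q ⟶ Q'),
      ((intTensor C).hom f g).mor = tensorMor f.mor g.mor := tensorHom_mor
    refine Eq.trans ?_ ((tensorMor_assoc f.mor g.mor h.mor).trans ?_)
    · rw [h₁, h₁]; rfl
    · rw [h₁, h₁]; rfl
  unit_hom f := by
    apply IntP.Hom.ext
    rw [cast_mor _ _ _ (leftUnitor_inv_eq _) (rightUnitor_inv_eq _)
      (StrictMonoidal.leftUnitor_hom _) (StrictMonoidal.rightUnitor_hom _)]
    refine Eq.trans ?_ (tensorMor_unit_left f.mor)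
    exact congrArg (fun k => _ ≫ k ≫ _) (tensorHom_mor _ f)
  hom_unit f := by
    apply IntP.Hom.ext
    rw [cast_mor _ _ _ (rightUnitor_inv_eq _) (leftUnitor_inv_eq _)
      (StrictMonoidal.rightUnitor_hom _) (StrictMonoidal.leftUnitor_hom _)]
    refine Eq.trans ?_ (tensorMor_unit_right f.mor)
    exact congrArg (fun k => _ ≫ k ≫ _) (tensorHom_mor f _)
  one_tensor_one A B :=
    IntP.Hom.ext ((tensorHom_mor (IntP.id A) (IntP.id B)).trans tensorMor_id)
  interchange f f' g g' k hk l hl := by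
    rw [mem_intComp_path₂_iff] at hk hl ⊢
    refine (congrArg₂ comp (ofHom_tensorHom f g) (ofHom_tensorHom f' g')).trans
      ((comp_tens _ _ _ _).trans ((congrArg₂ tens hk hl).trans ?_))
    exact (ofHom_tensorHom k l).symm
  one_tensor_path X A B p k hk := by
    rw [mem_intComp_iff] at hk
    refine (mem_intComp_iff _ _).2 ?_
    refine (pathGen_mapPath_left X p).trans ((congrArg (tens _) hk).trans ?_)
    exact (ofHom_tensorHom (IntP.id X) k).symm
  path_tensor_one X A B p k hk := by
    rw [mem_intComp_iff] at hk
    refine (mem_intComp_iff _ _).2 ?_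
    refine (pathGen_mapPath_right X p).trans ((congrArg (fun q => tens q _) hk).trans ?_)
    exact (ofHom_tensorHom k (IntP.id X)).symm
  symm_comp_dom f := Part.dom_iff_mem.2 ⟨⟨_⟩, (mem_intComp_iff _ _).2 (pathGen_symm_comp f)⟩
  comp_symm_dom g := Part.dom_iff_mem.2 ⟨⟨_⟩, (mem_intComp_iff _ _).2 (pathGen_comp_symm g)⟩
  symm_natural_left {A A'} B f := by
    apply intComp_eq_of_pathGen_eq
    rw [pathGen_symm_comp, pathGen_comp_symm]
    refine congrArg (ofHom T) (Eq.trans ?_ ((tensorMor_braiding_left f.mor).trans ?_))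
    · exact congrArg (fun k => _ ≫ k ≫ _) (tensorHom_mor f (IntP.id B))
    · exact congrArg (fun k => _ ≫ k ≫ _) (tensorHom_mor (IntP.id B) f).symm
  symm_natural_right A {B B'} g := by
    apply intComp_eq_of_pathGen_eq
    rw [pathGen_symm_comp, pathGen_comp_symm]
    refine congrArg (ofHom T) (Eq.trans ?_ ((tensorMor_braiding_right g.mor).trans ?_))
    · exact congrArg (fun k => _ ≫ k ≫ _) (tensorHom_mor (IntP.id A) g)
    · exact congrArg (fun k => _ ≫ k ≫ _) (tensorHom_mor g (IntP.id A)).symm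
  symm_symm A B := by
    rw [Part.eq_some_iff, mem_intComp_iff, pathGen_symm_comp]
    refine congrArg (ofHom T) ?_
    apply coherence (C := C) <;> repeat' constructor
  symm_hexagon A B D := by
    rw [Part.eq_some_iff, mem_intComp_iff, pathGen_comp_symm]
    rw [cast_mor _ _ _ (associator_inv_eq _ _ _) (StrictMonoidal.associator_hom _ _ _)
      (StrictMonoidal.associator_hom _ _ _) (associator_inv_eq _ _ _)]
    rw [cast_mor _ _ _ rfl (associator_inv_eq _ _ _)
      (associator_inv_eq _ _ _) rfl]
    refine congrArg (ofHom T) ?_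
    apply coherence <;> repeat' constructor

end Strict

end IntPara

namespace IntPara

variable {C : Type u} [Category.{v} C] [MonoidalCategory C]

/-! ### The embedding of the category -/

theorem intN_map_mor {X Y : C} (f : X ⟶ Y) : ((intN C).map f).mor = f ▷ 𝟙_ C :=
  (whiskerRight_id f).symm

theorem graphFull_intN : GraphFull (intN C) := fun X Y f => by
  refine ⟨(ρ_ X).inv ≫ f.mor ≫ (ρ_ Y).hom, IntP.Hom.ext ?_⟩
  simp [intN]

theorem graphFaithful_intN : GraphFaithful (intN C) := fun X Y f g h => by
  simpa [intN] using congrArg IntP.Hom.mor h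

variable [SymmetricCategory C]

open PartialTrace Gen

variable {T : PartialTrace C} {A B D : IntP C}

theorem pathGen_mapPath_intN {X Y : C} (p : Quiver.Path X Y) :
    pathGen T ((intN C).mapPath p) = ofHom T (composePath p ▷ 𝟙_ C) := by
  induction p with
  | nil => exact congrArg (ofHom T) (id_whiskerRight _ _).symm
  | cons p f ih =>
    refine (congrArg₂ comp ih (congrArg (ofHom T) (intN_map_mor f))).trans ?_
    rw [← tensorHom_id f]
    refine (comp_ofHom_tensor _ _ _).trans (congrArg (ofHom T) ?_)
    refine (congrArg (· ≫ _) (whiskerLeft_id _ _)).trans ((Category.id_comp _).trans ?_)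
    exact (comp_whiskerRight _ _ _).symm

/-- The composites of the arrows `N f` involve no feedback, so that they are always defined. -/
theorem isParaFunctor_intN (T : PartialTrace C) :
    IsParaFunctor (categoryPathOp C) (intComp T) (intN C) := by
  intro X Y p g hg
  rw [Part.mem_some_iff.1 hg, mem_intComp_iff, pathGen_mapPath_intN, intN_map_mor]
  rfl

/-! ### The pyramid of a single arrow -/

/-- The two crossings before `f` cancel, and the loop merely bends the strand leaving `f`. -/
theorem pyramidOneTwisted_eq (f : A ⟶ B) :
    pyramidOneTwisted f =
      f.mor ▷ A.neg ≫ rot B.pos A.neg A.neg ≫ 𝟙 (B.pos ⊗ A.neg) ▷ A.neg := by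
  simp only [pyramidOneTwisted, pyramidOne]
  apply around_coherence (f.mor ▷ A.neg) <;> repeat' constructor

theorem intComp_toPath (T : PartialTrace C) (f : A ⟶ B) :
    intComp T f.toPath = (T.tr A.neg (pyramidOneTwisted f)).map IntP.Hom.mk := by
  have h : f.mor ∈ T.tr A.neg (pyramidOneTwisted f) := by
    rw [mem_tr_iff, pyramidOneTwisted_eq, trace_yank, Category.comp_id]
  rw [Part.eq_some_iff.2 h, Part.map_some]
  rfl

/-! ### The triangle equations -/

theorem trace_trace_ofHom {X Y U V : C} (m : (X ⊗ U) ⊗ V ⟶ (Y ⊗ U) ⊗ V) :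
    trace (U ⊗ V) (ofHom T ((α_ X U V).inv ≫ m ≫ (α_ Y U V).hom)) =
      trace U (trace V (ofHom T m)) := by
  rw [trace_trace, conj_ofHom]

variable (T) in
/-- A strand `P` bent once through a loop and a strand `N` bent twice may both be straightened. -/
theorem trace_snake (P N : C) :
    trace ((N ⊗ P) ⊗ N) (ofHom T ((α_ (P ⊗ N) (N ⊗ P) N).inv ≫
      (rot P N (N ⊗ P) ▷ N ≫ rot (P ⊗ (N ⊗ P)) N N ≫
        ((β_ P (N ⊗ P)).hom ▷ N ≫ (α_ _ _ _).hom ≫ ((β_ N P).hom ⊗ₘ (β_ P N).hom)) ▷ N) ≫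
      (α_ (P ⊗ N) (N ⊗ P) N).hom)) = ofHom T (𝟙 (P ⊗ N)) := by
  have h₁ : rot P N (N ⊗ P) ≫ (β_ P (N ⊗ P)).hom ▷ N ≫ (α_ _ _ _).hom ≫
      ((β_ N P).hom ⊗ₘ (β_ P N).hom) = (α_ (P ⊗ N) N P).inv ≫
        (((α_ _ _ _).hom ≫ (β_ P (N ⊗ N)).hom) ▷ P ≫ rot (N ⊗ N) P P ≫
          ((β_ (N ⊗ N) P).hom ≫ P ◁ (β_ N N).hom ≫ (α_ _ _ _).inv) ▷ P) ≫
        (α_ (P ⊗ N) N P).hom := by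
    apply coherence <;> repeat' constructor
  have h₂ : ((α_ _ _ _).hom ≫ (β_ P (N ⊗ N)).hom) ≫ (β_ (N ⊗ N) P).hom ≫ P ◁ (β_ N N).hom ≫
      (α_ _ _ _).inv = 𝟙 (P ⊗ N) ▷ N ≫ rot P N N ≫ 𝟙 (P ⊗ N) ▷ N := by
    apply coherence <;> repeat' constructor
  -- The strands of the loop are straightened from right to left.
  rw [trace_trace_ofHom, trace_yank, h₁, trace_trace_ofHom, trace_yank, h₂, trace_yank,
    Category.id_comp]

section Strict

variable [StrictMonoidal C]

theorem snake_intComp (T : PartialTrace C) (A : IntP C) :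
    intComp T (path₂
        (((intTensor C).hom ((intDual C).η A) (IntP.id A)).cast (unit_tensor A)
          (tensor_assoc A ((intDual C).dual A) A))
        (((intTensor C).hom (IntP.id A) ((intDual C).ε A)).cast rfl (tensor_unit A))) =
      Part.some (IntP.id A) := by
  apply intComp_path₂_eq_some
  rw [cast_mor _ _ _ (leftUnitor_inv_eq _) (StrictMonoidal.associator_hom _ _ _)
    (StrictMonoidal.associator_hom _ _ _) (StrictMonoidal.rightUnitor_hom _)]
  rw [cast_mor _ _ _ rfl (leftUnitor_inv_eq _) (StrictMonoidal.rightUnitor_hom _) rfl]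
  rw [comp_ofHom]
  refine Eq.trans ?_ (trace_snake T A.pos A.neg)
  refine trace_ofHom_iso (Iso.refl ((A.neg ⊗ A.pos) ⊗ A.neg)) ?_
  apply coherence <;> repeat' constructor

theorem snake_dual_intComp (T : PartialTrace C) (A : IntP C) :
    intComp T (path₂
        (((intTensor C).hom (IntP.id ((intDual C).dual A)) ((intDual C).η A)).cast
          (tensor_unit _) (tensor_assoc ((intDual C).dual A) A ((intDual C).dual A)).symm)
        (((intTensor C).hom ((intDual C).ε A) (IntP.id ((intDual C).dual A))).cast rfl
          (unit_tensor _))) =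
      Part.some (IntP.id ((intDual C).dual A)) := by
  apply intComp_path₂_eq_some
  rw [cast_mor _ _ _ (rightUnitor_inv_eq _) (associator_inv_eq _ _ _)
    (associator_inv_eq _ _ _) (StrictMonoidal.leftUnitor_hom _)]
  rw [cast_mor _ _ _ rfl (rightUnitor_inv_eq _) (StrictMonoidal.leftUnitor_hom _) rfl]
  rw [comp_ofHom]
  refine Eq.trans ?_ (trace_snake T A.neg A.pos)
  refine trace_ofHom_iso (swapIso A.pos (A.neg ⊗ A.pos) ≪≫ whiskerRightIso (swapIso _ _) _) ?_
  apply coherence <;> repeat' constructor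

/-- The Int construction is a compact closed paracategory. -/
theorem isCompactClosedPara_intComp (T : PartialTrace C) :
    IsCompactClosedPara (intComp T) (intTensor C) (intDual C) where
  toIsSSMPC := isSSMPC_intComp T
  snake := snake_intComp T
  snake_dual := snake_dual_intComp T

end Strict

/-! ### The canonical trace -/

section CanonicalTrace

variable {X Y U : C}

/-- The first two factors `1 ⊗ η` and `f ⊗ 1` of the canonical trace compose to `f`, as `η` only
bends the strand `U`. -/
theorem comp_unit_tensor (f : X ⊗ U ⟶ Y ⊗ U) :
    comp (A := ⟨X, 𝟙_ C⟩) (B := ⟨(X ⊗ U) ⊗ 𝟙_ C, U ⊗ (𝟙_ C ⊗ 𝟙_ C)⟩)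
        (D := ⟨(Y ⊗ U) ⊗ 𝟙_ C, U ⊗ (𝟙_ C ⊗ 𝟙_ C)⟩)
        (ofHom T (X ◁ (U ◁ (λ_ (𝟙_ C)).hom ≫ (ρ_ U).hom) ≫ (ρ_ _).inv ≫ (ρ_ _).inv))
        (ofHom T (tensorMor ((𝟙 (X ⊗ U) ⊗ₘ (λ_ (𝟙_ C)).hom) ≫
          ((ρ_ (X ⊗ U)).hom ≫ f ≫ (ρ_ (Y ⊗ U)).inv) ≫ (𝟙 (Y ⊗ U) ⊗ₘ (λ_ (𝟙_ C)).inv))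
          (𝟙 (𝟙_ C ⊗ U)))) =
      ofHom T (X ◁ (U ◁ (λ_ (𝟙_ C)).hom ≫ (ρ_ U).hom) ≫ f ≫ (ρ_ _).inv ≫ (ρ_ _).inv) := by
  rw [comp_ofHom]
  refine Eq.trans ?_ ((trace_yank (V := U ⊗ (𝟙_ C ⊗ 𝟙_ C)) (𝟙 _) _).trans
    (congrArg (ofHom T) (Category.id_comp _)))
  refine congrArg (fun k => trace _ (ofHom T k)) ?_
  have h : f ▷ (U ⊗ (𝟙_ C ⊗ 𝟙_ C)) = (α_ _ _ _).inv ≫ f ▷ U ▷ (𝟙_ C ⊗ 𝟙_ C) ≫ (α_ _ _ _).hom :=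
    whiskerRight_tensor f _ _
  simp only [tensorMor, Category.assoc, comp_whiskerRight, tensorHom_id, h,
    whisker_iso f (ρ_ (𝟙_ C ⊗ U) ≪≫ λ_ U),
    whisker_iso f (whiskerLeftIso U (λ_ (𝟙_ C)) ≪≫ ρ_ U)]
  apply around_coherence (U ◁ f) <;> repeat' constructor

/-- The last two factors of the canonical trace feed the output `U` of `f` back to its input. -/
theorem comp_tensor_counit {f : X ⊗ U ⟶ Y ⊗ U} {t : X ⟶ Y} (h : t ∈ T.tr U f) :
    comp (A := ⟨X, 𝟙_ C⟩) (B := ⟨(Y ⊗ U) ⊗ 𝟙_ C, U ⊗ (𝟙_ C ⊗ 𝟙_ C)⟩) (D := ⟨Y, 𝟙_ C⟩)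
        (ofHom T (X ◁ (U ◁ (λ_ (𝟙_ C)).hom ≫ (ρ_ U).hom) ≫ f ≫ (ρ_ _).inv ≫ (ρ_ _).inv))
        (ofHom T ((ρ_ _).hom ≫ (ρ_ _).hom ≫ Y ◁ ((ρ_ U).inv ≫ U ◁ (λ_ (𝟙_ C)).inv))) =
      ofHom T ((ρ_ X).hom ≫ t ≫ (ρ_ Y).inv) := by
  rw [comp_ofHom, ← conj_ofHom _ _ t, ← trace_ofHom h, conj_trace, conj_ofHom]
  refine trace_ofHom_iso (whiskerLeftIso U (λ_ (𝟙_ C)) ≪≫ ρ_ U) ?_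
  simp only [Category.assoc, comp_whiskerRight, whiskerRight_id f]
  apply around_coherence f <;> repeat' constructor

variable [StrictMonoidal C]

/-- The functor `N` preserves the trace. -/
theorem intN_map_mem_trace {f : X ⊗ U ⟶ Y ⊗ U} {t : X ⟶ Y} (h : t ∈ T.tr U f) :
    (intN C).map t ∈ (isCompactClosedPara_intComp T).trace
      (Quiver.Hom.cast (intN_tensor X U) (intN_tensor Y U) ((intN C).map f)) := by
  refine (mem_intComp_iff _ _).2 ((pathGen_comp _ _).trans ?_)
  rw [pathGen_path₂, pathGen_path₂]
  refine Eq.trans (congrArg₂ comp (Eq.trans (congrArg₂ comp (congrArg (ofHom T) ?_)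
    (congrArg (ofHom T) ?_)) (comp_unit_tensor f)) ?_) (comp_tensor_counit h)
  · rw [cast_mor _ _ _ (rightUnitor_inv_eq _) (associator_inv_eq _ _ _)
      (associator_inv_eq _ _ _) (StrictMonoidal.leftUnitor_hom _)]
    apply coherence <;> repeat' constructor
  · refine (tensorHom_mor _ _).trans (congrArg (fun k => tensorMor k _) ?_)
    exact cast_mor _ _ _ rfl (StrictMonoidal.leftUnitor_hom _) rfl (leftUnitor_inv_eq _)
  · refine (congrArg₂ comp (congrArg (ofHom T) (?_ :
      _ = ((α_ Y U (𝟙_ C)).hom ≫ Y ◁ (β_ U (𝟙_ C)).hom) ⊗ₘ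
        ((ρ_ _).hom ≫ (λ_ U).hom ≫ (ρ_ U).inv ≫ U ◁ (λ_ (𝟙_ C)).inv))) rfl).trans
      ((comp_tensor_ofHom _ _ _).trans (congrArg (ofHom T) ?_))
    · rw [cast_mor _ _ _ (StrictMonoidal.associator_hom _ _ _) rfl rfl
        (StrictMonoidal.associator_hom _ _ _)]
      apply coherence <;> repeat' constructor
    · rw [cast_mor _ _ _ rfl (leftUnitor_inv_eq _) (StrictMonoidal.rightUnitor_hom _) rfl]
      apply coherence <;> repeat' constructor

end CanonicalTrace

end IntPara

theorem mainTheorem5 {C : Type u} [Category.{v} C] [MonoidalCategory C] [SymmetricCategory C]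
    [IntPara.StrictMonoidal C] (T : IntPara.PartialTrace C) :
    -- `Int^p(C)` is a strict symmetric monoidal paracategory
    IntPara.IsSSMPC (IntPara.intComp T) (IntPara.intTensor C) ∧
    -- the composite of a nonempty path is the trace of its pyramid (Kleene equality)
    (∀ {A B D : IntPara.IntP C} (p : Quiver.Path A B) (f : B ⟶ D),
      IntPara.intComp T (p.cons f) =
        (T.tr (IntPara.rev p) (IntPara.pyramidTwisted p f)).map IntPara.IntP.Hom.mk) ∧
    -- and is defined exactly when that trace is
    (∀ {A B D : IntPara.IntP C} (p : Quiver.Path A B) (f : B ⟶ D),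
      (IntPara.intComp T (p.cons f)).Dom ↔
        (T.tr (IntPara.rev p) (IntPara.pyramidTwisted p f)).Dom) ∧
    -- for a single arrow it is also the trace of the three-strand pyramid
    (∀ {A B : IntPara.IntP C} (f : A ⟶ B),
      IntPara.intComp T f.toPath =
        (T.tr A.neg (IntPara.pyramidOneTwisted f)).map IntPara.IntP.Hom.mk) ∧
    -- `N : C ⟶ Int^p(C)` is a full and faithful functor of paracategories
    IntPara.IsParaFunctor (IntPara.categoryPathOp C) (IntPara.intComp T) (IntPara.intN C) ∧
    IntPara.GraphFull (IntPara.intN C) ∧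
    IntPara.GraphFaithful (IntPara.intN C) ∧
    -- `Int^p(C)` is compact closed and `N` sends the partial trace to the canonical trace
    ∃ h : IntPara.IsCompactClosedPara (IntPara.intComp T) (IntPara.intTensor C)
        (IntPara.intDual C),
      ∀ {A B U : C} (f : A ⊗ U ⟶ B ⊗ U), ∀ t ∈ T.tr U f,
        (IntPara.intN C).map t ∈
          h.trace (Quiver.Hom.cast (IntPara.intN_tensor A U) (IntPara.intN_tensor B U)
            ((IntPara.intN C).map f)) := by
  have h := IntPara.isCompactClosedPara_intComp T
  refine ⟨h.toIsSSMPC, IntPara.intComp_cons T, fun p f => ?_, IntPara.intComp_toPath T,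
    IntPara.isParaFunctor_intN T, IntPara.graphFull_intN, IntPara.graphFaithful_intN, h,
    fun f t ht => IntPara.intN_map_mem_trace ht⟩
  rw [IntPara.intComp_cons]
  rfl
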